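/- For $\tau$ in the upper half-plane $\mathbb H$ put $q=e^{2\pi i\tau}$, and let $$j(\tau)=\frac{\bigl(1+240\sum_{n\ge 1}\sigma_3(n)q^n\bigr)^3}{q\prod_{n\ge 1}(1-q^n)^{24}}=q^{-1}+744+196884q+\cdots .$$ For each integer $n\ge 0$ let $F_n\in\mathbb Z[y]$ be the Faber polynomial, i.e. the unique polynomial with $F_n(j(\tau))=q^{-n}+O(q)$. Let $A(q)=1+a(1)q+a(2)q^2+\cdots$ be a formal power series with real coefficients $a(n)$. For $k\ge 1$ put $$P_k(A;y)=F_k(y)+\sum_{n=0}^{k-1}a(k-n)F_n(y)\in\mathbb R[y].$$ Let $M\ge 1.1176$ be a real number (for example the constant $M\approx 1.1176\ldots$ of Asai, Kaneko and Ninomiya). Suppose that the series $$S=\sum_{n=1}^{\infty}|a(n)|e^{-\pi n\sqrt 3}$$ converges and that $S<\dfrac{2-M}{2+M}$. Then for every integer $k\ge 1$ the following hold. The polynomial $P_k(A;y)$ has degree $k$. The function $f_k(A;\tau)=P_k(A;j(\tau))$ is the unique weakly holomorphic modular function on $\mathrm{SL}_2(\mathbb Z)$ (holomorphic on $\mathbb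 H$, invariant under $\mathrm{SL}_2(\mathbb Z)$, at most a pole at the cusp) satisfying $f_k(A;\tau)=q^{-k}A(q)+O(q)$. The polynomial $P_k(A;y)$ has exactly $k$ distinct real zeros in the open interval $(0,1728)$. -/

import Mathlib

namespace FaberZeros

noncomputable section

open Complex Real Filter Asymptotics
open UpperHalfPlane hiding I
open scoped Polynomial PowerSeries LaurentSeries Manifold MatrixGroups ArithmeticFunction.sigma

/-- The nome `q = exp (2 π i τ)`. -/
def nome (τ : ℍ) : ℂ := cexp (2 * π * Complex.I * τ)

/-- The modular invariant `j = E₄ ^ 3 / Δ`, normalised so that `j = q⁻¹ + 744 + O(q)`. -/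
def kleinJ (τ : ℍ) : ℂ := ModularForm.E₄ τ ^ 3 / ModularForm.discriminant τ

/-- The product formula for `j`: it is
`(1 + 240 ∑_{n ≥ 1} σ₃(n) qⁿ) ^ 3 / (q ∏_{n ≥ 1} (1 - qⁿ) ^ 24)`. -/
theorem kleinJ_eq (τ : ℍ) :
    kleinJ τ = (1 + 240 * ∑' n : ℕ+, (σ 3 n : ℂ) * nome τ ^ (n : ℕ)) ^ 3 /
      (nome τ * ∏' n : ℕ, (1 - nome τ ^ (n + 1)) ^ 24) := by
  have h4 : (bernoulli 4 : ℚ) = -1 / 30 := by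
    rw [bernoulli_eq_bernoulli'_of_ne_one (by norm_num), bernoulli'_four]
  have hE := EisensteinSeries.q_expansion_bernoulli (k := 4) (by norm_num) (by decide) τ
  rw [h4] at hE
  have hE' : ModularForm.E₄ τ = 1 + 240 * ∑' n : ℕ+, (σ 3 n : ℂ) * nome τ ^ (n : ℕ) := by
    refine hE.trans ?_
    simp only [nome, zpow_natCast]
    norm_num
  have hD : ModularForm.discriminant τ = nome τ * ∏' n : ℕ, (1 - nome τ ^ (n + 1)) ^ 24 := by
    rw [ModularForm.discriminant_eq_q_prod]
    simp [ModularForm.eta_q, Function.Periodic.qParam, nome]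
  rw [kleinJ, hE', hD]

/-- A weakly holomorphic modular function on `SL₂(ℤ)`: holomorphic on the upper half-plane,
invariant under `SL₂(ℤ)`, and with at most a pole at the cusp `i∞`. -/
structure IsWeaklyHolomorphicModularFunction (f : ℍ → ℂ) : Prop where
  holo : MDifferentiable 𝓘(ℂ) 𝓘(ℂ) f
  invariant : ∀ (γ : SL(2, ℤ)) (τ : ℍ), f (γ • τ) = f τ
  meromorphic_at_cusp : ∃ N : ℕ, f =O[atImInfty] fun τ ↦ nome τ ^ (-(N : ℤ))

/-- `f` is a weakly holomorphic modular function on `SL₂(ℤ)` with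
`f = q⁻ᵏ A(q) + O(q)`. Only the terms `a(n) qⁿ` of `A` with `n ≤ k` are not absorbed by `O(q)`. -/
def IsAssociated (A : ℝ⟦X⟧) (k : ℕ) (f : ℍ → ℂ) : Prop :=
  IsWeaklyHolomorphicModularFunction f ∧
    (fun τ ↦ f τ - ∑ n ∈ Finset.range (k + 1),
      ((PowerSeries.coeff n A : ℝ) : ℂ) * nome τ ^ ((n : ℤ) - (k : ℤ))) =O[atImInfty] nome

/-- The power series `1 + 240 ∑_{n ≥ 1} σ₃(n) qⁿ`. -/
def eisensteinFour : ℤ⟦X⟧ := PowerSeries.mk fun n ↦ if n = 0 then 1 else 240 * (σ 3 n : ℤ)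

/-- The power series `∏_{n ≥ 1} (1 - qⁿ) ^ 24`: its coefficient of `qⁿ` involves only the first
`n` factors. -/
def eulerProduct : ℤ⟦X⟧ := PowerSeries.mk fun n ↦
  PowerSeries.coeff n (∏ i ∈ Finset.range n, (1 - (PowerSeries.X : ℤ⟦X⟧) ^ (i + 1)) ^ 24)

/-- The `q`-expansion of `q j`; `PowerSeries.invOfUnit φ 1` is the inverse of a power series `φ`
with constant coefficient `1`. -/
def qjSeries : ℤ⟦X⟧ := eisensteinFour ^ 3 * PowerSeries.invOfUnit eulerProduct 1

/-- The `q`-expansion `q⁻¹ + 744 + 196884 q + ⋯` of `j`, as a formal Laurent series. -/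
def jSeries : ℤ⸨X⸩ := HahnSeries.single (-1) 1 * HahnSeries.ofPowerSeries ℤ ℤ qjSeries

/-- `F(j) = q⁻ⁿ + O(q)`. -/
def IsFaberPolynomial (n : ℕ) (F : ℤ[X]) : Prop :=
  ∀ m : ℤ, m ≤ 0 → (Polynomial.aeval jSeries F).coeff m = if m = -(n : ℤ) then 1 else 0

theorem constantCoeff_qjSeries : PowerSeries.constantCoeff qjSeries = 1 := by
  have h : PowerSeries.constantCoeff eisensteinFour = 1 := by
    rw [← PowerSeries.coeff_zero_eq_constantCoeff_apply, eisensteinFour, PowerSeries.coeff_mk]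
    simp
  simp [qjSeries, h, PowerSeries.constantCoeff_invOfUnit]

theorem coeff_jSeries_pow (n : ℕ) (m : ℤ) :
    (jSeries ^ n).coeff m = ((qjSeries ^ n : ℤ⟦X⟧) : ℤ⸨X⸩).coeff (m + n) := by
  rw [jSeries, mul_pow, HahnSeries.single_pow, ← map_pow]
  simp [HahnSeries.coeff_single_mul]

theorem coeff_jSeries_pow_self (n : ℕ) : (jSeries ^ n).coeff (-(n : ℤ)) = 1 := by
  rw [coeff_jSeries_pow, PowerSeries.coeff_coe]
  simp [constantCoeff_qjSeries]

theorem coeff_jSeries_pow_of_lt (n : ℕ) (m : ℤ) (hm : m < -(n : ℤ)) :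
    (jSeries ^ n).coeff m = 0 := by
  rw [coeff_jSeries_pow, PowerSeries.coeff_coe, if_pos (by omega)]

theorem exists_isFaberPolynomial (n : ℕ) : ∃ F : ℤ[X], IsFaberPolynomial n F := by
  induction n using Nat.strong_induction_on with
  | _ n ih =>
    choose! F hF using ih
    refine ⟨Polynomial.X ^ n - ∑ i ∈ Finset.range n,
      Polynomial.C ((jSeries ^ n).coeff (-(i : ℤ))) * F i, fun m hm ↦ ?_⟩
    have hsum : (Polynomial.aeval jSeries (∑ i ∈ Finset.range n,
        Polynomial.C ((jSeries ^ n).coeff (-(i : ℤ))) * F i)).coeff m =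
        ∑ i ∈ Finset.range n, (jSeries ^ n).coeff (-(i : ℤ)) * if m = -(i : ℤ) then 1 else 0 := by
      rw [map_sum, HahnSeries.coeff_sum]
      refine Finset.sum_congr rfl fun i hi ↦ ?_
      rw [← hF i (Finset.mem_range.mp hi) m hm, Polynomial.C_mul', map_zsmul,
        HahnSeries.coeff_smul, smul_eq_mul]
    rw [map_sub, HahnSeries.coeff_sub, hsum, map_pow, Polynomial.aeval_X]
    obtain ⟨r, rfl⟩ : ∃ r : ℕ, m = -(r : ℤ) := ⟨m.natAbs, by omega⟩
    simp only [neg_inj, Nat.cast_inj, mul_ite, mul_one, mul_zero, Finset.sum_ite_eq,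
      Finset.mem_range]
    rcases lt_trichotomy r n with h | rfl | h
    · simp [h, h.ne]
    · simp [coeff_jSeries_pow_self]
    · rw [coeff_jSeries_pow_of_lt n _ (by omega)]
      simp [h.not_gt, h.ne']

theorem eq_zero_of_coeff_aeval_jSeries (D : ℤ[X])
    (hD : ∀ m : ℤ, m ≤ 0 → (Polynomial.aeval jSeries D).coeff m = 0) : D = 0 := by
  rw [← Polynomial.leadingCoeff_eq_zero]
  have h := hD (-(D.natDegree : ℤ)) (by omega)
  have hsmul (c : ℤ) (i : ℕ) (m : ℤ) :
      (Polynomial.aeval jSeries (Polynomial.monomial i c)).coeff m =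
        c * (jSeries ^ i).coeff m := by
    rw [← Polynomial.C_mul_X_pow_eq_monomial, Polynomial.C_mul', map_zsmul, map_pow,
      Polynomial.aeval_X, HahnSeries.coeff_smul, smul_eq_mul]
  rw [Polynomial.as_sum_range D, map_sum, HahnSeries.coeff_sum, Finset.sum_range_succ,
    ← Polynomial.as_sum_range D, Finset.sum_eq_zero fun i hi ↦ ?_] at h
  · rwa [zero_add, hsmul, coeff_jSeries_pow_self, mul_one] at h
  · rw [hsmul, coeff_jSeries_pow_of_lt, mul_zero]
    have := Finset.mem_range.mp hi
    omega

theorem existsUnique_isFaberPolynomial (n : ℕ) : ∃! F : ℤ[X], IsFaberPolynomial n F := by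
  obtain ⟨F, hF⟩ := exists_isFaberPolynomial n
  refine ⟨F, hF, fun G hG ↦ sub_eq_zero.mp <| eq_zero_of_coeff_aeval_jSeries _ fun m hm ↦ ?_⟩
  rw [map_sub, HahnSeries.coeff_sub, hF m hm, hG m hm, sub_self]

/-- The Faber polynomial `F_n`: the unique polynomial with `F_n(j) = q⁻ⁿ + O(q)`. -/
def faberPolynomial (n : ℕ) : ℤ[X] := (existsUnique_isFaberPolynomial n).choose

/-- The polynomial `P_k(A; y) = F_k(y) + ∑_{n = 0}^{k - 1} a(k - n) F_n(y)`. -/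
def faberCombination (A : ℝ⟦X⟧) (k : ℕ) : ℝ[X] :=
  (faberPolynomial k).map (Int.castRingHom ℝ) +
    ∑ n ∈ Finset.range k,
      Polynomial.C (PowerSeries.coeff (k - n) A) * (faberPolynomial n).map (Int.castRingHom ℝ)

end

end FaberZeros

namespace FaberZeros

noncomputable section

open Complex Real Filter Asymptotics
open UpperHalfPlane hiding I
open scoped Polynomial PowerSeries LaurentSeries Manifold MatrixGroups ArithmeticFunction.sigma
open scoped Topology ModularForm

/-! On the arc `|τ| = 1`, `0 ≤ Re τ ≤ 1/2`, the invariant `j` is real and decreases from 1728 at `i`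
to 0 at `e^{πi/3}`. It therefore suffices to find `k + 1` points of the arc at which `P_k(A; j)`
alternates in sign: the intermediate value theorem yields `k` zeros in `(0, 1728)`, and the degree
allows no more (`ncard_zeros_of_sign_changes`).

The size of `F_n(j(τ))` comes from a Hecke sum. Both `F_n(j)` and the sum of `(j - 744)((aτ + b)/d)`
over `ad = n`, `0 ≤ b < d`, are holomorphic, `SL₂(ℤ)`-invariant and equal to `q⁻ⁿ + o(1)`, so they
coincide (`aeval_kleinJ_faberPolynomial`). On the arc, with `τ = x + iy` and `n ≥ 2`, three summands
dominate; their arguments are equivalent to `nτ`, `-n τ̄` and `n/(1 - τ)`. They contribute `2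
cos(2πnx) e^{2πny} + (-1)ⁿ e^{2πny/(2-2x)}`. Every other argument is equivalent only to points of
height at most `ny/2`, so the total error is at most `e^{2πny}/2`
(`norm_aeval_faberPolynomial_sub_le`).

At `x = i/(2k)` the cosine is `(-1)^i`, whence `(-1)^i F_k(j) ≥ 1.4 e^{2πky}`
(`le_aeval_arcJ_sample`). Always `|F_n(j)| ≤ 4.5 e^{2πny}` (`abs_aeval_arcJ_le`), and `y ≥ √3/2`, so
the lower terms of `P_k` add up to at most `4.5 S e^{2πky}`. The bound on `M` gives `S ≤ 0.284`, and
`4.5 · 0.284 = 1.278 < 1.4`, so `F_k` decides the sign.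

The same estimate yields the monotonicity of `j` on the arc: points of different heights are
separated by some `F_n` (`injOn_arcJ`). Uniqueness of `f_k` holds because an invariant holomorphic
function vanishing at the cusp is zero. Since Faber polynomials are defined by formal Laurent
series, `HasExpansion` carries formal coefficients over to estimates as `q → 0`. -/

/-! ### Asymptotic expansions at the cusp -/

/-- `f` is the asymptotic expansion of `g` at `0`. -/
def HasExpansion (f : ℤ⟦X⟧) (g : ℂ → ℂ) : Prop :=
  ∀ N : ℕ, ∃ p : ℤ[X], (∀ m < N, p.coeff m = PowerSeries.coeff m f) ∧
    (fun q ↦ g q - Polynomial.aeval q p) =O[𝓝 0] fun q : ℂ ↦ q ^ N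

theorem isBigO_one_aeval (p : ℤ[X]) :
    (fun q : ℂ ↦ Polynomial.aeval q p) =O[𝓝 0] fun _ ↦ (1 : ℂ) :=
  (Polynomial.continuous_aeval p).continuousAt.isBigO_one ℂ

theorem isBigO_aeval_of_coeff_eq_zero {p : ℤ[X]} {N : ℕ} (hp : ∀ m < N, p.coeff m = 0) :
    (fun q : ℂ ↦ Polynomial.aeval q p) =O[𝓝 0] fun q ↦ q ^ N := by
  obtain ⟨r, rfl⟩ := Polynomial.X_pow_dvd_iff.mpr hp
  simpa using (isBigO_refl (fun q : ℂ ↦ q ^ N) (𝓝 0)).mul (isBigO_one_aeval r)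

theorem HasExpansion.isBigO_sub {f : ℤ⟦X⟧} {g : ℂ → ℂ} (h : HasExpansion f g) {N : ℕ} {p : ℤ[X]}
    (hp : ∀ m < N, p.coeff m = PowerSeries.coeff m f) :
    (fun q ↦ g q - Polynomial.aeval q p) =O[𝓝 0] fun q : ℂ ↦ q ^ N := by
  obtain ⟨p', hp', hO⟩ := h N
  have := isBigO_aeval_of_coeff_eq_zero (p := p' - p) (N := N)
    fun m hm ↦ by rw [Polynomial.coeff_sub, hp m hm, hp' m hm, sub_self]
  refine (hO.add this).congr_left fun q ↦ ?_
  simp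

theorem HasExpansion.isBigO_one {f : ℤ⟦X⟧} {g : ℂ → ℂ} (h : HasExpansion f g) :
    g =O[𝓝 0] fun _ ↦ (1 : ℂ) := by
  obtain ⟨p, -, hO⟩ := h 0
  simp only [pow_zero] at hO
  simpa only [sub_add_cancel] using hO.add (isBigO_one_aeval p)

theorem hasExpansion_coe (p : ℤ[X]) : HasExpansion p fun q ↦ Polynomial.aeval q p :=
  fun N ↦ ⟨p, by simp, by simpa using isBigO_zero _ _⟩

theorem HasExpansion.add {f₁ f₂ : ℤ⟦X⟧} {g₁ g₂ : ℂ → ℂ} (h₁ : HasExpansion f₁ g₁)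
    (h₂ : HasExpansion f₂ g₂) : HasExpansion (f₁ + f₂) fun q ↦ g₁ q + g₂ q := by
  intro N
  obtain ⟨p₁, hp₁, hO₁⟩ := h₁ N
  obtain ⟨p₂, hp₂, hO₂⟩ := h₂ N
  refine ⟨p₁ + p₂, fun m hm ↦ by simp [hp₁ m hm, hp₂ m hm], ?_⟩
  refine (hO₁.add hO₂).congr_left fun q ↦ ?_
  simp only [map_add]
  ring

theorem HasExpansion.mul {f₁ f₂ : ℤ⟦X⟧} {g₁ g₂ : ℂ → ℂ} (h₁ : HasExpansion f₁ g₁)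
    (h₂ : HasExpansion f₂ g₂) : HasExpansion (f₁ * f₂) fun q ↦ g₁ q * g₂ q := by
  intro N
  obtain ⟨p₁, hp₁, hO₁⟩ := h₁ N
  obtain ⟨p₂, hp₂, hO₂⟩ := h₂ N
  refine ⟨p₁ * p₂, fun m hm ↦ ?_, ?_⟩
  · rw [Polynomial.coeff_mul, PowerSeries.coeff_mul]
    refine Finset.sum_congr rfl fun x hx ↦ ?_
    have := Finset.HasAntidiagonal.mem_antidiagonal.mp hx
    rw [hp₁ _ (by omega), hp₂ _ (by omega)]
  · have e₁ := hO₁.mul h₂.isBigO_one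
    have e₂ := (isBigO_one_aeval p₁).mul hO₂
    simp only [mul_one, one_mul] at e₁ e₂
    refine (e₁.add e₂).congr_left fun q ↦ ?_
    simp only [map_mul]
    ring

theorem HasExpansion.pow {f : ℤ⟦X⟧} {g : ℂ → ℂ} (h : HasExpansion f g) (n : ℕ) :
    HasExpansion (f ^ n) fun q ↦ g q ^ n := by
  induction n with
  | zero => simpa using hasExpansion_coe 1
  | succ n ih => simpa only [pow_succ] using ih.mul h

theorem HasExpansion.tendsto {f : ℤ⟦X⟧} {g : ℂ → ℂ} (h : HasExpansion f g) :
    Tendsto g (𝓝 0) (𝓝 (PowerSeries.constantCoeff f : ℤ)) := by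
  have hO := h.isBigO_sub (N := 1) (p := Polynomial.C (PowerSeries.constantCoeff f))
    fun m hm ↦ by
      obtain rfl : m = 0 := by omega
      simp
  have : Tendsto (fun q : ℂ ↦ q ^ 1) (𝓝 0) (𝓝 0) := by
    simp only [pow_one]
    exact tendsto_id
  simpa using (hO.trans_tendsto this).add_const ((PowerSeries.constantCoeff f : ℤ) : ℂ)

theorem HasExpansion.inv {f : ℤ⟦X⟧} {g : ℂ → ℂ} (h : HasExpansion f g)
    (hf : PowerSeries.constantCoeff f = 1) :
    HasExpansion (PowerSeries.invOfUnit f 1) fun q ↦ (g q)⁻¹ := by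
  intro N
  set p := PowerSeries.trunc N f
  set p' := PowerSeries.trunc N (PowerSeries.invOfUnit f 1)
  have hp : ∀ m < N, p.coeff m = PowerSeries.coeff m f := fun m hm ↦ by
    simp [p, PowerSeries.coeff_trunc, hm]
  have hp' : ∀ m < N, p'.coeff m = PowerSeries.coeff m (PowerSeries.invOfUnit f 1) :=
    fun m hm ↦ by simp [p', PowerSeries.coeff_trunc, hm]
  refine ⟨p', hp', ?_⟩
  have ht : Tendsto g (𝓝 0) (𝓝 1) := by simpa [hf] using h.tendsto
  have hinv : (fun q ↦ (g q)⁻¹) =O[𝓝 0] fun _ ↦ (1 : ℂ) := (ht.inv₀ one_ne_zero).isBigO_one ℂ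
  have hne : ∀ᶠ q in 𝓝 (0 : ℂ), g q ≠ 0 := ht.eventually_ne one_ne_zero
  have h1 : (fun q ↦ 1 - Polynomial.aeval q (p * p')) =O[𝓝 0] fun q : ℂ ↦ q ^ N := by
    refine (isBigO_aeval_of_coeff_eq_zero (p := 1 - p * p') fun m hm ↦ ?_).congr_left
      fun q ↦ by simp
    have : (p * p').coeff m = PowerSeries.coeff m (f * PowerSeries.invOfUnit f 1) := by
      rw [Polynomial.coeff_mul, PowerSeries.coeff_mul]
      refine Finset.sum_congr rfl fun x hx ↦ ?_
      have := Finset.HasAntidiagonal.mem_antidiagonal.mp hx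
      rw [hp _ (by omega), hp' _ (by omega)]
    rw [Polynomial.coeff_sub, this, PowerSeries.mul_invOfUnit _ _ (by simpa using hf)]
    simp [Polynomial.coeff_one, PowerSeries.coeff_one]
  have h2 := (h.isBigO_sub hp).mul (isBigO_one_aeval p')
  simp only [mul_one] at h2
  -- With `p p' ≡ 1 mod q^N`, this is the identity `1/g - p' = (1/g) ((1 - p p') - (g - p) p')`.
  have h3 := hinv.mul (h1.sub h2)
  simp only [one_mul] at h3
  refine h3.congr' ?_ .rfl
  filter_upwards [hne] with q hq
  simp only [map_mul]
  field_simp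
  ring

/-- `1 + 240 ∑ σ₃(n) qⁿ` as a function of `q`. -/
def eisensteinFun (q : ℂ) : ℂ := 1 + 240 * ∑' n : ℕ+, (σ 3 n : ℂ) * q ^ (n : ℕ)

/-- `∏ (1 - qⁿ)` as a function of `q`. -/
def eulerFun (q : ℂ) : ℂ := ∏' n : ℕ, (1 - q ^ (n + 1))

/-! ### The nome and the expansion of `q j` -/

theorem nome_ne_zero (τ : ℍ) : nome τ ≠ 0 := Complex.exp_ne_zero _

theorem norm_nome (τ : ℍ) : ‖nome τ‖ = Real.exp (-(2 * π * τ.im)) := by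
  simp [nome, Complex.norm_exp]

theorem norm_nome_lt_one (τ : ℍ) : ‖nome τ‖ < 1 := by
  rw [norm_nome, Real.exp_lt_one_iff, neg_lt_zero]
  have := τ.im_pos
  positivity

theorem tendsto_nome : Tendsto nome atImInfty (𝓝 0) := by
  refine (UpperHalfPlane.qParam_tendsto_atImInfty zero_lt_one).congr fun τ ↦ ?_
  simp [nome, Function.Periodic.qParam]

theorem eulerFun_pow {q : ℂ} (hq : ‖q‖ < 1) :
    ∏' n : ℕ, (1 - q ^ (n + 1)) ^ 24 = eulerFun q ^ 24 :=
  (ModularForm.multipliable_one_sub_pow hq).tprod_pow 24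

theorem nome_mul_kleinJ (τ : ℍ) :
    nome τ * kleinJ τ = eisensteinFun (nome τ) ^ 3 * (eulerFun (nome τ) ^ 24)⁻¹ := by
  rw [kleinJ_eq, eulerFun_pow (norm_nome_lt_one τ), eisensteinFun]
  have := nome_ne_zero τ
  field_simp

theorem sigma_three_le (n : ℕ) : σ 3 n ≤ n ^ 4 := by
  rw [ArithmeticFunction.sigma_apply]
  calc ∑ d ∈ n.divisors, d ^ 3 ≤ ∑ d ∈ n.divisors, n ^ 3 :=
        Finset.sum_le_sum fun d hd ↦ Nat.pow_le_pow_left (Nat.divisor_le hd) 3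
    _ = n.divisors.card * n ^ 3 := by simp
    _ ≤ n * n ^ 3 := Nat.mul_le_mul_right _ (Nat.card_divisors_le_self n)
    _ = n ^ 4 := by ring

theorem norm_sigma_three_mul_le (n : ℕ) (q : ℂ) :
    ‖((σ 3 n : ℕ) : ℂ) * q ^ n‖ ≤ (n : ℝ) ^ 4 * ‖q‖ ^ n := by
  rw [norm_mul, norm_pow, Complex.norm_natCast]
  gcongr
  exact_mod_cast sigma_three_le n

theorem summable_sigma_three {q : ℂ} (hq : ‖q‖ < 1) :
    Summable fun n : ℕ ↦ ((σ 3 n : ℕ) : ℂ) * q ^ n :=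
  .of_norm_bounded (summable_pow_mul_geometric_of_norm_lt_one 4 (by simpa using hq))
    fun n ↦ norm_sigma_three_mul_le n q

theorem eisensteinFun_eq (q : ℂ) :
    eisensteinFun q = 1 + 240 * ∑' n : ℕ, ((σ 3 n : ℕ) : ℂ) * q ^ n := by
  rw [eisensteinFun]
  congr 2
  refine Function.Injective.tsum_eq (f := fun n : ℕ ↦ ((σ 3 n : ℕ) : ℂ) * q ^ n)
    PNat.coe_injective fun n hn ↦ ⟨⟨n, Nat.pos_of_ne_zero ?_⟩, rfl⟩
  rintro rfl
  simp at hn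

theorem hasExpansion_eisensteinFour : HasExpansion eisensteinFour eisensteinFun := by
  intro N
  refine ⟨1 + 240 * ∑ n ∈ Finset.range N, Polynomial.C ((σ 3 n : ℕ) : ℤ) * Polynomial.X ^ n,
    fun m hm ↦ ?_, ?_⟩
  · have : (240 : ℤ[X]) = Polynomial.C 240 := rfl
    simp only [eisensteinFour, PowerSeries.coeff_mk, Polynomial.coeff_add, this,
      Polynomial.coeff_C_mul, Polynomial.finsetSum_coeff, Polynomial.coeff_X_pow,
      Polynomial.coeff_one]
    by_cases h0 : m = 0 <;> simp [h0, hm]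
  · have hs : Summable fun n : ℕ ↦ ((n + N : ℕ) : ℝ) ^ 4 * (1 / 2 : ℝ) ^ (n + N) :=
      (summable_nat_add_iff N).mpr
        (summable_pow_mul_geometric_of_norm_lt_one 4 (r := (1 / 2 : ℝ)) (by norm_num))
    refine .of_bound (240 * (∑' n : ℕ, ((n + N : ℕ) : ℝ) ^ 4 * (1 / 2 : ℝ) ^ (n + N)) * 2 ^ N) ?_
    filter_upwards [Metric.ball_mem_nhds (0 : ℂ) (show (0 : ℝ) < 1 / 2 by norm_num)] with q hq
    have hq : ‖q‖ < 1 / 2 := by simpa using hq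
    have e : eisensteinFun q - Polynomial.aeval q (1 + 240 * ∑ n ∈ Finset.range N,
        Polynomial.C ((σ 3 n : ℕ) : ℤ) * Polynomial.X ^ n : ℤ[X]) =
        240 * ∑' n : ℕ, ((σ 3 (n + N) : ℕ) : ℂ) * q ^ (n + N) := by
      rw [eisensteinFun_eq,
        ← (summable_sigma_three (hq.trans (by norm_num))).sum_add_tsum_nat_add N]
      simp only [map_add, map_mul, map_one, map_ofNat, map_sum, map_pow,
        Polynomial.aeval_X, map_natCast]
      ring
    rw [e, norm_mul, norm_pow, mul_assoc, mul_assoc]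
    norm_num only [RCLike.norm_ofNat]
    gcongr
    rw [← tsum_mul_right]
    refine tsum_of_norm_bounded (hs.mul_right _).hasSum fun n ↦ ?_
    refine (norm_sigma_three_mul_le _ _).trans ?_
    rw [mul_assoc]
    gcongr
    rw [pow_add, pow_add, mul_assoc, ← mul_assoc ((1 / 2 : ℝ) ^ N), ← mul_pow]
    norm_num only [one_pow, one_mul]
    gcongr

theorem norm_tprod_one_add_sub_one_le {f : ℕ → ℂ} (hf : Summable fun n ↦ ‖f n‖) :
    ‖∏' n, (1 + f n) - 1‖ ≤ Real.exp (∑' n, ‖f n‖) - 1 := by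
  have h1 := (multipliable_one_add_of_summable hf).hasProd.tendsto_prod_nat
  refine le_of_tendsto (h1.sub_const 1).norm (.of_forall fun n ↦ ?_)
  refine ((Finset.range n).norm_prod_one_add_sub_one_le f).trans ?_
  gcongr
  exact hf.sum_le_tsum _ fun _ _ ↦ norm_nonneg _

theorem norm_tprod_one_sub_pow_sub_one_le {q : ℂ} (hq : ‖q‖ < 1) (N : ℕ) :
    ‖∏' n : ℕ, (1 - q ^ (n + N)) - 1‖ ≤ Real.exp (‖q‖ ^ N / (1 - ‖q‖)) - 1 := by
  have hs : Summable fun n : ℕ ↦ ‖-q ^ (n + N)‖ := by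
    simpa using (summable_nat_add_iff N).mpr (summable_geometric_of_lt_one (norm_nonneg q) hq)
  have := norm_tprod_one_add_sub_one_le hs
  simp only [← sub_eq_add_neg] at this
  have e (n : ℕ) : ‖-q ^ (n + N)‖ = ‖q‖ ^ n * ‖q‖ ^ N := by rw [norm_neg, norm_pow, pow_add]
  rwa [tsum_congr e, tsum_mul_right, tsum_geometric_of_lt_one (norm_nonneg q) hq, mul_comm,
    ← div_eq_mul_inv] at this

theorem eulerFun_eq {q : ℂ} (hq : ‖q‖ < 1) (N : ℕ) :
    eulerFun q = (∏ n ∈ Finset.range N, (1 - q ^ (n + 1))) * ∏' n : ℕ, (1 - q ^ (n + (N + 1))) := by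
  have hs : Summable fun n : ℕ ↦ ‖-q ^ (n + (N + 1))‖ := by
    simpa using (summable_nat_add_iff (N + 1)).mpr
      (summable_geometric_of_lt_one (norm_nonneg q) hq)
  have hm := multipliable_one_add_of_summable hs
  simp only [← sub_eq_add_neg, ← add_assoc] at hm
  simpa only [add_assoc, eulerFun] using
    (Multipliable.prod_mul_tprod_nat_mul' (f := fun n : ℕ ↦ 1 - q ^ (n + 1)) (k := N) hm).symm

/-- Each further factor is congruent to 1 modulo `X^(N+1)`, so the coefficients up to degree `N` no
longer change; this reconciles the coefficientwise truncations in `eulerProduct` with a single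
finite product. -/
theorem coeff_prod_one_sub_X_pow {m N : ℕ} (h : m ≤ N) :
    (∏ i ∈ Finset.range N, (1 - (Polynomial.X : ℤ[X]) ^ (i + 1)) ^ 24).coeff m =
      PowerSeries.coeff m eulerProduct := by
  induction N, h using Nat.le_induction with
  | base =>
    rw [eulerProduct, PowerSeries.coeff_mk, ← Polynomial.coeff_coe]
    congr 1
    rw [← Polynomial.coeToPowerSeries.ringHom_apply]
    simp
  | succ N h ih =>
    rw [Finset.prod_range_succ, ← ih, ← sub_eq_zero, ← Polynomial.coeff_sub]
    have hd : (Polynomial.X : ℤ[X]) ^ (N + 1) ∣ (1 - Polynomial.X ^ (N + 1)) ^ 24 - 1 := by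
      simpa using sub_dvd_pow_sub_pow (1 - (Polynomial.X : ℤ[X]) ^ (N + 1)) 1 24
    refine Polynomial.X_pow_dvd_iff.mp (?_ : Polynomial.X ^ (N + 1) ∣ _) m (by omega)
    rw [← mul_sub_one]
    exact hd.mul_left _

theorem isBigO_tprod_one_sub_pow_sub_one (N : ℕ) :
    (fun q : ℂ ↦ ∏' n : ℕ, (1 - q ^ (n + (N + 1))) - 1) =O[𝓝 0] fun q ↦ q ^ (N + 1) := by
  refine .of_bound 4 ?_
  filter_upwards [Metric.ball_mem_nhds (0 : ℂ) (show (0 : ℝ) < 1 / 2 by norm_num)] with q hq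
  have hq : ‖q‖ < 1 / 2 := by simpa using hq
  refine (norm_tprod_one_sub_pow_sub_one_le (hq.trans (by norm_num)) (N + 1)).trans ?_
  have h0 := norm_nonneg q
  have h1 : ‖q‖ ^ (N + 1) ≤ 1 / 2 :=
    (pow_le_of_le_one h0 (by linarith) (by omega)).trans hq.le
  have h2 : ‖q‖ ^ (N + 1) / (1 - ‖q‖) ≤ 2 * ‖q‖ ^ (N + 1) := by
    rw [div_le_iff₀ (by linarith)]
    nlinarith [pow_nonneg h0 (N + 1)]
  have h3 : 0 ≤ ‖q‖ ^ (N + 1) / (1 - ‖q‖) := by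
    have : 0 ≤ 1 - ‖q‖ := by linarith
    positivity
  have h4 := abs_le.mp (Real.abs_exp_sub_one_sub_id_le (x := ‖q‖ ^ (N + 1) / (1 - ‖q‖))
    (abs_le.mpr ⟨by linarith, by linarith⟩))
  rw [norm_pow]
  nlinarith

theorem hasExpansion_eulerProduct : HasExpansion eulerProduct fun q ↦ eulerFun q ^ 24 := by
  intro N
  refine ⟨∏ i ∈ Finset.range N, (1 - (Polynomial.X : ℤ[X]) ^ (i + 1)) ^ 24,
    fun m hm ↦ coeff_prod_one_sub_X_pow hm.le, ?_⟩
  set p : ℤ[X] := ∏ i ∈ Finset.range N, (1 - (Polynomial.X : ℤ[X]) ^ (i + 1)) ^ 24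
  have h0 := isBigO_tprod_one_sub_pow_sub_one N
  have hX : (fun q : ℂ ↦ q ^ (N + 1)) =O[𝓝 0] fun q ↦ q ^ N := by
    simpa using isBigO_aeval_of_coeff_eq_zero (p := Polynomial.X ^ (N + 1)) (N := N)
      fun m hm ↦ by simp [Polynomial.coeff_X_pow]; omega
  have h1 : Tendsto (fun q : ℂ ↦ ∏' n : ℕ, (1 - q ^ (n + (N + 1)))) (𝓝 0) (𝓝 1) := by
    have : Tendsto (fun q : ℂ ↦ q ^ (N + 1)) (𝓝 0) (𝓝 0) := by
      simpa using ((continuous_pow (M := ℂ) (N + 1)).tendsto 0)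
    simpa using (h0.trans_tendsto this).add_const 1
  have h2 : (fun q : ℂ ↦ (∏' n : ℕ, (1 - q ^ (n + (N + 1)))) ^ 24 - 1) =O[𝓝 0]
      fun q ↦ q ^ N := by
    have hg : (fun q : ℂ ↦ ∑ i ∈ Finset.range 24, (∏' n : ℕ, (1 - q ^ (n + (N + 1)))) ^ i)
        =O[𝓝 0] fun _ ↦ (1 : ℂ) :=
      (tendsto_finsetSum _ fun i _ ↦ h1.pow i).isBigO_one ℂ
    have := hg.mul (h0.trans hX)
    simpa only [one_mul, geom_sum_mul] using this
  have h3 := (isBigO_one_aeval p).mul h2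
  simp only [one_mul] at h3
  refine h3.congr' ?_ .rfl
  filter_upwards [Metric.ball_mem_nhds (0 : ℂ) zero_lt_one] with q hq
  rw [eulerFun_eq (by simpa using hq) N, mul_pow, ← Finset.prod_pow]
  simp only [p, map_prod, map_pow, map_sub, map_one, Polynomial.aeval_X]
  ring

theorem hasExpansion_qjSeries :
    HasExpansion qjSeries fun q ↦ eisensteinFun q ^ 3 * (eulerFun q ^ 24)⁻¹ := by
  have h : PowerSeries.constantCoeff eulerProduct = 1 := by
    rw [← PowerSeries.coeff_zero_eq_constantCoeff_apply, eulerProduct, PowerSeries.coeff_mk]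
    simp
  exact (hasExpansion_eisensteinFour.pow 3).mul (hasExpansion_eulerProduct.inv h)

/-! ### Faber polynomials -/

theorem isFaberPolynomial_faberPolynomial (n : ℕ) : IsFaberPolynomial n (faberPolynomial n) :=
  (existsUnique_isFaberPolynomial n).choose_spec.1

theorem coeff_aeval_jSeries (F : ℤ[X]) (m : ℤ) :
    (Polynomial.aeval jSeries F).coeff m =
      ∑ i ∈ Finset.range (F.natDegree + 1), F.coeff i * (jSeries ^ i).coeff m := by
  conv_lhs => rw [Polynomial.as_sum_range F, map_sum, HahnSeries.coeff_sum]
  refine Finset.sum_congr rfl fun i _ ↦ ?_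
  rw [← Polynomial.C_mul_X_pow_eq_monomial, Polynomial.C_mul', map_zsmul, map_pow,
    Polynomial.aeval_X, HahnSeries.coeff_smul, smul_eq_mul]

theorem coeff_aeval_jSeries_natDegree (F : ℤ[X]) :
    (Polynomial.aeval jSeries F).coeff (-(F.natDegree : ℤ)) = F.leadingCoeff := by
  rw [coeff_aeval_jSeries, Finset.sum_range_succ, Finset.sum_eq_zero fun i hi ↦ ?_]
  · rw [coeff_jSeries_pow_self, zero_add, mul_one, Polynomial.leadingCoeff]
  · have := Finset.mem_range.mp hi
    rw [coeff_jSeries_pow_of_lt _ _ (by omega), mul_zero]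

theorem IsFaberPolynomial.ne_zero {n : ℕ} {F : ℤ[X]} (hF : IsFaberPolynomial n F) : F ≠ 0 := by
  rintro rfl
  simpa using hF (-n) (by omega)

theorem IsFaberPolynomial.natDegree_eq {n : ℕ} {F : ℤ[X]} (hF : IsFaberPolynomial n F) :
    F.natDegree = n := by
  have h := hF (-F.natDegree) (by omega)
  rw [coeff_aeval_jSeries_natDegree] at h
  by_contra hne
  rw [if_neg (by omega), Polynomial.leadingCoeff_eq_zero] at h
  exact hF.ne_zero h

theorem IsFaberPolynomial.monic {n : ℕ} {F : ℤ[X]} (hF : IsFaberPolynomial n F) : F.Monic := by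
  rw [Polynomial.Monic, ← coeff_aeval_jSeries_natDegree, hF.natDegree_eq, hF _ (by omega),
    if_pos rfl]

theorem HasExpansion.sum {ι : Type*} (s : Finset ι) {f : ι → ℤ⟦X⟧} {g : ι → ℂ → ℂ}
    (h : ∀ i ∈ s, HasExpansion (f i) (g i)) :
    HasExpansion (∑ i ∈ s, f i) fun q ↦ ∑ i ∈ s, g i q := by
  classical
  induction s using Finset.induction_on with
  | empty => simpa using hasExpansion_coe 0
  | insert a s ha ih =>
    simp only [Finset.sum_insert ha]
    exact (h a (Finset.mem_insert_self a s)).add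
      (ih fun i hi ↦ h i (Finset.mem_insert_of_mem hi))

/-- `q j` as a function of `q`. -/
def qjFun (q : ℂ) : ℂ := eisensteinFun q ^ 3 * (eulerFun q ^ 24)⁻¹

/-- Multiplying `F(j)` by `q^(deg F)` clears the pole and leaves a polynomial in `q` and `q j`, to
which power series expansions apply. -/
theorem hasExpansion_homogenize (F : ℤ[X]) :
    HasExpansion (∑ i ∈ Finset.range (F.natDegree + 1),
        ((Polynomial.C (F.coeff i) * Polynomial.X ^ (F.natDegree - i) : ℤ[X]) : ℤ⟦X⟧) *
          qjSeries ^ i)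
      fun q ↦ ∑ i ∈ Finset.range (F.natDegree + 1),
        (F.coeff i * q ^ (F.natDegree - i)) * qjFun q ^ i :=
  .sum _ fun i _ ↦ by
    have := (hasExpansion_coe (Polynomial.C (F.coeff i) *
      Polynomial.X ^ (F.natDegree - i) : ℤ[X])).mul (hasExpansion_qjSeries.pow i)
    simpa only [map_mul, map_pow, Polynomial.aeval_X, Polynomial.aeval_C, eq_intCast, map_intCast,
      qjFun] using this

theorem coeff_homogenize (F : ℤ[X]) (m : ℕ) :
    PowerSeries.coeff m (∑ i ∈ Finset.range (F.natDegree + 1),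
        ((Polynomial.C (F.coeff i) * Polynomial.X ^ (F.natDegree - i) : ℤ[X]) : ℤ⟦X⟧) *
          qjSeries ^ i) = (Polynomial.aeval jSeries F).coeff ((m : ℤ) - F.natDegree) := by
  rw [coeff_aeval_jSeries, map_sum]
  refine Finset.sum_congr rfl fun i hi ↦ ?_
  have hi' := Finset.mem_range.mp hi
  rw [coeff_jSeries_pow, PowerSeries.coeff_coe, Polynomial.coe_mul, Polynomial.coe_C, mul_assoc,
    PowerSeries.coeff_C_mul, Polynomial.coe_pow, Polynomial.coe_X, PowerSeries.coeff_X_pow_mul']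
  split_ifs with h1 h2 h2
  · omega
  · congr
    omega
  · simp
  · omega

theorem nome_pow_mul_aeval (F : ℤ[X]) (τ : ℍ) :
    ∑ i ∈ Finset.range (F.natDegree + 1),
        (F.coeff i * nome τ ^ (F.natDegree - i)) * qjFun (nome τ) ^ i =
      nome τ ^ F.natDegree * Polynomial.aeval (kleinJ τ) F := by
  rw [Polynomial.aeval_eq_sum_range, Finset.mul_sum]
  refine Finset.sum_congr rfl fun i hi ↦ ?_
  have hi' := Finset.mem_range.mp hi
  rw [qjFun, ← nome_mul_kleinJ, mul_pow, zsmul_eq_mul]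
  rw [← pow_sub_mul_pow (nome τ) (Nat.lt_succ_iff.mp hi')]
  ring

/-- Since `deg F = n`, the homogenised series is `1 + O(q^(n+1))`; dividing by `qⁿ` turns the formal
condition into an analytic one. -/
theorem IsFaberPolynomial.isBigO {n : ℕ} {F : ℤ[X]} (hF : IsFaberPolynomial n F) :
    (fun τ ↦ Polynomial.aeval (kleinJ τ) F - nome τ ^ (-(n : ℤ))) =O[atImInfty] nome := by
  have h := ((hasExpansion_homogenize F).isBigO_sub (N := n + 1) (p := 1) fun m hm ↦ ?_).comp_tendsto
    tendsto_nome
  · simp only [Function.comp_def, nome_pow_mul_aeval, map_one] at h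
    rw [hF.natDegree_eq] at h
    have := (isBigO_refl (fun τ ↦ (nome τ ^ n)⁻¹) atImInfty).mul h
    refine (this.congr_left fun τ ↦ ?_).congr_right fun τ ↦ ?_
    · have := nome_ne_zero τ
      rw [zpow_neg, zpow_natCast]
      field_simp
    · have := nome_ne_zero τ
      rw [pow_succ]
      field_simp
  · rw [coeff_homogenize, hF.natDegree_eq, hF _ (by omega), Polynomial.coeff_one]
    congr 1
    simp

/-! ### The modular invariant -/

theorem mem_SL (γ : SL(2, ℤ)) : (γ : GL (Fin 2) ℝ) ∈ 𝒮ℒ := ⟨γ, rfl⟩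

theorem denom_coe_SL (γ : SL(2, ℤ)) (τ : ℍ) :
    denom (γ : GL (Fin 2) ℝ) τ = (γ 1 0 : ℂ) * τ + γ 1 1 := by
  simp [denom]

theorem modularForm_smul {k : ℤ} (f : ModularForm 𝒮ℒ k) (γ : SL(2, ℤ)) (τ : ℍ) :
    f (γ • τ) = ((γ 1 0 : ℂ) * τ + γ 1 1) ^ k * f τ := by
  rw [← denom_coe_SL]
  exact SlashInvariantForm.slash_action_eqn'' f (mem_SL γ) τ

theorem discriminant_smul (γ : SL(2, ℤ)) (τ : ℍ) :
    ModularForm.discriminant (γ • τ) =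
      ((γ 1 0 : ℂ) * τ + γ 1 1) ^ 12 * ModularForm.discriminant τ := by
  rw [← denom_coe_SL]
  exact SlashInvariantForm.slash_action_eqn'' CuspForm.discriminant (mem_SL γ) τ

theorem kleinJ_smul (γ : SL(2, ℤ)) (τ : ℍ) : kleinJ (γ • τ) = kleinJ τ := by
  have h : ((γ 1 0 : ℂ) * τ + γ 1 1) ≠ 0 := denom_coe_SL γ τ ▸ denom_ne_zero _ τ
  rw [kleinJ, kleinJ, modularForm_smul, discriminant_smul, mul_pow]
  have : (((γ 1 0 : ℂ) * τ + γ 1 1) ^ (4 : ℤ)) ^ 3 = ((γ 1 0 : ℂ) * τ + γ 1 1) ^ 12 := by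
    rw [show (4 : ℤ) = ((4 : ℕ) : ℤ) from rfl, zpow_natCast, ← pow_mul]
  rw [this, mul_div_mul_left _ _ (pow_ne_zero _ h)]

theorem mdifferentiable_kleinJ : MDifferentiable 𝓘(ℂ) 𝓘(ℂ) kleinJ :=
  (ModularForm.E₄.holo'.pow 3).div CuspForm.discriminant.holo' ModularForm.discriminant_ne_zero

theorem mdifferentiable_aeval_kleinJ {R : Type*} [CommRing R] [Algebra R ℂ] (F : R[X]) :
    MDifferentiable 𝓘(ℂ) 𝓘(ℂ) fun τ ↦ Polynomial.aeval (kleinJ τ) F := by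
  have := mdifferentiable_kleinJ
  rw [UpperHalfPlane.mdifferentiable_iff] at this ⊢
  exact (Polynomial.differentiable_aeval (𝕜 := ℂ) F).comp_differentiableOn this

/-- Such a function is a modular form of level one and weight 0, hence constant, and the constant is
its limit at the cusp. -/
theorem eq_zero_of_tendsto_zero {f : ℍ → ℂ} (hf : MDifferentiable 𝓘(ℂ) 𝓘(ℂ) f)
    (hinv : ∀ (γ : SL(2, ℤ)) (τ : ℍ), f (γ • τ) = f τ) (h0 : Tendsto f atImInfty (𝓝 0)) :
    f = 0 := by
  have hslash (γ : SL(2, ℤ)) : f ∣[(0 : ℤ)] γ = f := by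
    ext τ
    simp only [ModularForm.SL_slash_apply, neg_zero, zpow_zero, mul_one, hinv]
  let g : ModularForm 𝒮ℒ 0 :=
    { toFun := f
      slash_action_eq' := fun _ ⟨γ, hγ⟩ ↦ hγ ▸ hslash γ
      holo' := hf
      bdd_at_cusps' := fun hc ↦ by
        rw [Subgroup.IsArithmetic.isCusp_iff_isCusp_SL2Z] at hc
        rw [OnePoint.isBoundedAt_iff_forall_SL2Z hc]
        intro γ _
        rw [hslash]
        exact h0.isBigO_one ℝ }
  obtain ⟨c, hc⟩ := ModularFormClass.levelOne_weight_zero_const g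
  have hc : f = Function.const ℍ c := hc
  rw [hc] at h0
  rw [hc, tendsto_nhds_unique tendsto_const_nhds h0]
  rfl

theorem coe_S_smul (τ : ℍ) : ((ModularGroup.S • τ : ℍ) : ℂ) = -(τ : ℂ)⁻¹ := by
  rw [UpperHalfPlane.modular_S_smul, UpperHalfPlane.coe_mk, inv_neg]

/-- `S` fixes `i` and `E₆` has weight 6, so `E₆(i) = i⁶ E₆(i) = -E₆(i)` vanishes; then `1728 Δ =
E₄³` at `i`. -/
theorem kleinJ_I : kleinJ UpperHalfPlane.I = 1728 := by
  have h6 := modularForm_smul ModularForm.E₆ ModularGroup.S UpperHalfPlane.I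
  have hS : ModularGroup.S • UpperHalfPlane.I = UpperHalfPlane.I := by
    ext
    rw [coe_S_smul]
    simp
  have h0 : ModularForm.E₆ UpperHalfPlane.I = 0 := by
    have hI : Complex.I ^ (6 : ℤ) = -1 := by
      rw [show (6 : ℤ) = ((6 : ℕ) : ℤ) from rfl, zpow_natCast]
      linear_combination (Complex.I ^ 4 - Complex.I ^ 2 + 1) * Complex.I_sq
    rw [hS] at h6
    simp only [ModularGroup.S, Matrix.SpecialLinearGroup.coe_mk, Matrix.of_apply,
      Matrix.cons_val_zero, Matrix.cons_val_one, Int.cast_one, Int.cast_zero, one_mul, add_zero,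
      UpperHalfPlane.coe_I, hI, neg_one_mul] at h6
    exact self_eq_neg.mp h6
  have hD := ModularForm.discriminant_eq_E₄_cube_sub_E₆_sq UpperHalfPlane.I
  rw [h0] at hD
  rw [kleinJ, div_eq_iff (ModularForm.discriminant_ne_zero _), hD]
  ring

/-- The hypothesis says that `S` and `T⁻¹` agree at `τ`. Comparing the two transformation laws gives
`τ⁴ E₄(τ) = E₄(τ)`. -/
theorem kleinJ_eq_zero {τ : ℍ} (h : (τ : ℂ) ^ 2 = τ - 1) : kleinJ τ = 0 := by
  have h4 := modularForm_smul ModularForm.E₄ ModularGroup.S τ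
  have hT := modularForm_smul ModularForm.E₄ ModularGroup.T⁻¹ τ
  have hne := τ.ne_zero
  have hST : ModularGroup.S • τ = ModularGroup.T⁻¹ • τ := by
    ext
    rw [coe_S_smul, ← zpow_neg_one ModularGroup.T, UpperHalfPlane.modular_T_zpow_smul,
      UpperHalfPlane.coe_vadd]
    field_simp
    push_cast
    linear_combination -h
  rw [hST, hT, ← sub_eq_zero, ← sub_mul] at h4
  rcases mul_eq_zero.mp h4 with h4 | h4
  · simp only [ModularGroup.S, ModularGroup.coe_T_inv, Matrix.SpecialLinearGroup.coe_mk,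
      Matrix.of_apply, Matrix.cons_val_zero, Matrix.cons_val_one, Int.cast_one, Int.cast_zero,
      one_mul, add_zero, zero_mul, zero_add, zpow_ofNat] at h4
    -- Here `τ³ = -1`, so `τ⁴ = 1` would give `τ = -1`, which is not in the upper half-plane.
    have : (τ : ℂ) = -1 := by linear_combination h4 + ((τ : ℂ) ^ 2 + τ) * h
    have h' := congrArg Complex.im this
    simp [τ.im_ne_zero] at h'
  · rw [kleinJ, h4]
    simp

/-! ### Real values on the unit circle -/

theorem eisensteinFun_conj (q : ℂ) :
    eisensteinFun ((starRingEnd ℂ) q) = (starRingEnd ℂ) (eisensteinFun q) := by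
  simp only [eisensteinFun, map_add, map_mul, map_one, map_ofNat, Complex.conj_tsum, map_natCast,
    map_pow]

theorem eulerFun_conj {q : ℂ} (hq : ‖q‖ < 1) :
    eulerFun ((starRingEnd ℂ) q) = (starRingEnd ℂ) (eulerFun q) := by
  rw [eulerFun, eulerFun, (ModularForm.multipliable_one_sub_pow hq).map_tprod (starRingEnd ℂ)
    Complex.continuous_conj]
  simp

theorem nome_S_smul {τ : ℍ} (h : ‖(τ : ℂ)‖ = 1) :
    nome (ModularGroup.S • τ) = (starRingEnd ℂ) (nome τ) := by
  rw [nome, nome, coe_S_smul, ← Complex.exp_conj, Complex.inv_eq_conj h]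
  simp only [map_mul, map_ofNat, Complex.conj_ofReal, Complex.conj_I]
  congr 1
  ring

/-- On the unit circle `-1/τ = -τ̄`, so `S` conjugates the nome; the expansion of `j` has real
coefficients and `j` is invariant under `S`. -/
theorem conj_kleinJ {τ : ℍ} (h : ‖(τ : ℂ)‖ = 1) : (starRingEnd ℂ) (kleinJ τ) = kleinJ τ := by
  have h1 := nome_mul_kleinJ τ
  have h2 := nome_mul_kleinJ (ModularGroup.S • τ)
  rw [nome_S_smul h, kleinJ_smul, eisensteinFun_conj, eulerFun_conj (norm_nome_lt_one τ)] at h2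
  have h3 := congrArg (starRingEnd ℂ) h1
  rw [map_mul, map_mul, map_inv₀, map_pow, map_pow, ← h2] at h3
  exact mul_left_cancel₀ (by simpa using nome_ne_zero τ) h3

/-! ### Numerical bounds near the cusp -/

/-- This bounds `|q|` by `1/220` at heights at least `√3/2`. As `220 > 14²`, it also gives `e^{πy} ≥
14` there. -/
theorem two_twenty_le_exp : 220 ≤ Real.exp (π * √3) := by
  have h3 : 1.732 ≤ √3 := Real.le_sqrt_of_sq_le (by norm_num)
  have hx : 5 + 0.438 ≤ π * √3 := by nlinarith [Real.pi_gt_d2]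
  refine le_trans ?_ (Real.exp_le_exp.mpr hx)
  have h1 : (2.718 : ℝ) ^ 5 ≤ Real.exp 5 := by
    rw [show (5 : ℝ) = ((5 : ℕ) : ℝ) * 1 by norm_num, Real.exp_nat_mul]
    gcongr
    linarith [Real.exp_one_gt_d9]
  have h2 := Real.quadratic_le_exp_of_nonneg (show (0 : ℝ) ≤ 0.438 by norm_num)
  rw [Real.exp_add]
  calc (220 : ℝ) ≤ 2.718 ^ 5 * (1 + 0.438 + 0.438 ^ 2 / 2) := by norm_num
    _ ≤ _ := by gcongr

theorem norm_nome_le {τ : ℍ} (h : √3 / 2 ≤ τ.im) : ‖nome τ‖ ≤ 1 / 220 := by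
  rw [norm_nome, Real.exp_neg, ← one_div]
  refine one_div_le_one_div_of_le (by norm_num) (two_twenty_le_exp.trans (Real.exp_le_exp.mpr ?_))
  nlinarith [Real.pi_pos]

theorem norm_eisensteinFun_sub_le {q : ℂ} (hq : ‖q‖ ≤ 1 / 220) :
    ‖eisensteinFun q - 1 - 240 * q‖ ≤ 4000 * ‖q‖ ^ 2 := by
  have h0 := norm_nonneg q
  have e : eisensteinFun q - 1 - 240 * q =
      240 * ∑' n : ℕ, ((σ 3 (n + 2) : ℕ) : ℂ) * q ^ (n + 2) := by
    rw [eisensteinFun_eq,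
      ← (summable_sigma_three (hq.trans_lt (by norm_num))).sum_add_tsum_nat_add 2]
    simp [Finset.sum_range_succ]
    ring
  -- The ratio of consecutive fourth powers is at most `(3/2)⁴ < 6`, so the tail is dominated by a
  -- geometric series of ratio `6|q|`.
  have h4 (n : ℕ) : ((n + 2 : ℕ) : ℝ) ^ 4 ≤ 16 * 6 ^ n := by
    induction n with
    | zero => norm_num
    | succ n ih =>
      have : ((n + 1 + 2 : ℕ) : ℝ) ^ 4 ≤ 6 * ((n + 2 : ℕ) : ℝ) ^ 4 := by
        push_cast
        have : (0 : ℝ) ≤ n := n.cast_nonneg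
        have : 0 ≤ 5 * (n : ℝ) ^ 4 + 36 * (n : ℝ) ^ 3 + 90 * (n : ℝ) ^ 2 + 84 * n + 15 := by
          positivity
        linarith
      rw [pow_succ (6 : ℝ)]
      linarith
  have hs : HasSum (fun n : ℕ ↦ 16 * ‖q‖ ^ 2 * (6 * ‖q‖) ^ n)
      (16 * ‖q‖ ^ 2 * (1 - 6 * ‖q‖)⁻¹) :=
    (hasSum_geometric_of_lt_one (by positivity) (by linarith)).mul_left _
  have hb := tsum_of_norm_bounded (f := fun n : ℕ ↦ ((σ 3 (n + 2) : ℕ) : ℂ) * q ^ (n + 2)) hs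
    fun n ↦ by
      refine (norm_sigma_three_mul_le _ _).trans ?_
      calc ((n + 2 : ℕ) : ℝ) ^ 4 * ‖q‖ ^ (n + 2) ≤ (16 * 6 ^ n) * ‖q‖ ^ (n + 2) := by
            gcongr
            exact h4 n
        _ = _ := by ring
  have hi : (1 - 6 * ‖q‖)⁻¹ ≤ 220 / 214 := by
    rw [inv_le_comm₀ (by linarith) (by norm_num)]
    linarith
  rw [e, norm_mul]
  norm_num only [RCLike.norm_ofNat]
  calc 240 * ‖∑' n : ℕ, ((σ 3 (n + 2) : ℕ) : ℂ) * q ^ (n + 2)‖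
      ≤ 240 * (16 * ‖q‖ ^ 2 * (220 / 214)) := by
        gcongr
        exact hb.trans (by gcongr)
    _ ≤ 4000 * ‖q‖ ^ 2 := by nlinarith [sq_nonneg ‖q‖]

theorem norm_eulerFun_sub_le {q : ℂ} (hq : ‖q‖ ≤ 1 / 220) :
    ‖eulerFun q - 1 + q‖ ≤ 1.2 * ‖q‖ ^ 2 := by
  have h0 := norm_nonneg q
  have h1 : ‖q‖ < 1 := by linarith
  have hT := norm_tprod_one_sub_pow_sub_one_le h1 2
  rw [eulerFun_eq h1 1]
  set T := ∏' n : ℕ, (1 - q ^ (n + 2))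
  have hx : ‖q‖ ^ 2 / (1 - ‖q‖) ≤ 1.01 * ‖q‖ ^ 2 := by
    rw [div_le_iff₀ (by linarith)]
    nlinarith [sq_nonneg ‖q‖]
  have hx0 : 0 ≤ ‖q‖ ^ 2 / (1 - ‖q‖) := by
    have : 0 ≤ 1 - ‖q‖ := by linarith
    positivity
  have hq2 : ‖q‖ ^ 2 ≤ 1 / 220 * ‖q‖ := by nlinarith
  have hx1 : ‖q‖ ^ 2 / (1 - ‖q‖) ≤ 1 / 220 := by linarith
  have hexp := abs_le.mp (Real.abs_exp_sub_one_sub_id_le (x := ‖q‖ ^ 2 / (1 - ‖q‖))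
    (abs_le.mpr ⟨by linarith, by linarith⟩))
  have hT' : ‖T - 1‖ ≤ 1.1 * ‖q‖ ^ 2 := by nlinarith
  have e : (∏ n ∈ Finset.range 1, (1 - q ^ (n + 1))) * T - 1 + q = (1 - q) * (T - 1) := by
    simp
    ring
  have hn : ‖1 - q‖ ≤ 1 + 1 / 220 := (norm_sub_le _ _).trans (by simpa using hq)
  rw [e, norm_mul]
  calc ‖1 - q‖ * ‖T - 1‖ ≤ (1 + 1 / 220) * (1.1 * ‖q‖ ^ 2) := by gcongr
    _ ≤ 1.2 * ‖q‖ ^ 2 := by nlinarith [sq_nonneg ‖q‖]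

/-- A majorant: the polynomial has nonnegative coefficients in `u`, so `u` may be replaced by `‖u‖`.
-/
theorem norm_one_add_pow_sub_le (u : ℂ) (n : ℕ) :
    ‖(1 + u) ^ n - 1 - n * u‖ ≤ (1 + ‖u‖) ^ n - 1 - n * ‖u‖ := by
  induction n with
  | zero => simp
  | succ n ih =>
    have e : (1 + u) ^ (n + 1) - 1 - (n + 1 : ℕ) * u =
        (1 + u) * ((1 + u) ^ n - 1 - n * u) + n * (u * u) := by
      push_cast
      ring
    have h1 : ‖1 + u‖ ≤ 1 + ‖u‖ := (norm_add_le _ _).trans (by simp)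
    rw [e]
    calc _ ≤ ‖1 + u‖ * ‖(1 + u) ^ n - 1 - n * u‖ + n * (‖u‖ * ‖u‖) := by
          refine (norm_add_le _ _).trans ?_
          simp
      _ ≤ (1 + ‖u‖) * ((1 + ‖u‖) ^ n - 1 - n * ‖u‖) + n * (‖u‖ * ‖u‖) := by
          gcongr
      _ = _ := by
          push_cast
          ring

theorem norm_one_add_pow_sub_le_sq {u : ℂ} {n : ℕ} (h : n * ‖u‖ ≤ 1) :
    ‖(1 + u) ^ n - 1 - n * u‖ ≤ (n * ‖u‖) ^ 2 := by
  have h1 : (1 + ‖u‖) ^ n ≤ Real.exp (n * ‖u‖) := by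
    rw [Real.exp_nat_mul]
    gcongr
    linarith [Real.add_one_le_exp ‖u‖]
  have h0 : 0 ≤ n * ‖u‖ := by positivity
  have h2 := abs_le.mp (Real.abs_exp_sub_one_sub_id_le (x := n * ‖u‖)
    (abs_le.mpr ⟨by linarith, h⟩))
  linarith [norm_one_add_pow_sub_le u n]

theorem norm_eulerFun_pow_sub_le {q : ℂ} (hq : ‖q‖ ≤ 1 / 220) :
    ‖eulerFun q ^ 24 - 1 + 24 * q‖ ≤ 620 * ‖q‖ ^ 2 := by
  have h0 := norm_nonneg q
  have h := norm_eulerFun_sub_le hq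
  set u := eulerFun q - 1 with hu
  have hq2 : ‖q‖ ^ 2 ≤ 1 / 220 * ‖q‖ := by nlinarith
  have hun : ‖u‖ ≤ 1.01 * ‖q‖ := by
    have : u = (u + q) - q := by ring
    rw [this]
    refine (norm_sub_le _ _).trans ?_
    linarith
  have h1 := norm_one_add_pow_sub_le_sq (u := u) (n := 24) (by push_cast; linarith)
  have e : eulerFun q ^ 24 - 1 + 24 * q = ((1 + u) ^ 24 - 1 - (24 : ℕ) * u) + 24 * (u + q) := by
    rw [hu]
    push_cast
    ring
  have h2 : ((24 : ℕ) * ‖u‖) ^ 2 ≤ (24 * (1.01 * ‖q‖)) ^ 2 := by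
    push_cast
    gcongr
  have h3 : ‖24 * (u + q)‖ ≤ 24 * (1.2 * ‖q‖ ^ 2) := by
    rw [norm_mul, RCLike.norm_ofNat]
    gcongr
  have h4 : (24 * (1.01 * ‖q‖)) ^ 2 ≤ 588 * ‖q‖ ^ 2 := by nlinarith [sq_nonneg ‖q‖]
  rw [e]
  refine (norm_add_le _ _).trans ((add_le_add ((h1.trans h2).trans h4) h3).trans ?_)
  linarith [sq_nonneg ‖q‖]

/-- With `P = ∏(1 - qⁿ)²⁴`, the difference is `(E₄³ - (1 + 744q)P)/(qP)`. The linear terms of the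
numerator cancel because `3·240 = 744 - 24`, and what remains is a multiple of `q²`. -/
theorem norm_kleinJ_sub_le_mul_norm_nome {τ : ℍ} (hτ : √3 / 2 ≤ τ.im) :
    ‖kleinJ τ - 744 - (nome τ)⁻¹‖ ≤ 400000 * ‖nome τ‖ := by
  have hq := norm_nome_le hτ
  have hJ := nome_mul_kleinJ τ
  have hq0 := nome_ne_zero τ
  set q := nome τ
  have h0 : 0 < ‖q‖ := norm_pos_iff.mpr hq0
  have hE := norm_eisensteinFun_sub_le hq
  have hP := norm_eulerFun_pow_sub_le hq
  have hq2 : ‖q‖ ^ 2 ≤ 1 / 220 * ‖q‖ := by nlinarith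
  set e := eisensteinFun q - 1 - 240 * q with he
  set P := eulerFun q ^ 24
  set v := P - 1 + 24 * q with hv
  have hPn : 0.87 ≤ ‖P‖ := by
    have h1 : (1 : ℂ) = P - v + 24 * q := by rw [hv]; ring
    have h2 : ‖(1 : ℂ)‖ ≤ ‖P‖ + ‖v‖ + 24 * ‖q‖ := by
      conv_lhs => rw [h1]
      refine (norm_add_le _ _).trans (add_le_add (norm_sub_le _ _) ?_)
      simp
    rw [norm_one] at h2
    linarith
  have hP0 : P ≠ 0 := norm_pos_iff.mp (by linarith)
  have hEe : eisensteinFun q = 1 + 240 * q + e := by rw [he]; ring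
  have hPv : P = 1 - 24 * q + v := by rw [hv]; ring
  have key : kleinJ τ - 744 - q⁻¹ = (172800 * q ^ 2 + 13824000 * q ^ 3 + 3 * (1 + 240 * q) ^ 2 * e
      + 3 * (1 + 240 * q) * e ^ 2 + e ^ 3 - v - 744 * q * (v - 24 * q)) / (q * P) := by
    have : kleinJ τ = eisensteinFun q ^ 3 / (q * P) := by
      rw [eq_div_iff (mul_ne_zero hq0 hP0)]
      linear_combination P * hJ + eisensteinFun q ^ 3 * mul_inv_cancel₀ hP0
    rw [this, hEe]
    field_simp
    rw [hPv]
    ring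
  have ha : ‖1 + 240 * q‖ ≤ 2.1 := by
    refine (norm_add_le _ _).trans ?_
    simp only [norm_one, norm_mul, RCLike.norm_ofNat]
    linarith
  have he1 : ‖e‖ ≤ 0.084 := by linarith
  have t1 : ‖172800 * q ^ 2‖ = 172800 * ‖q‖ ^ 2 := by simp
  have t2 : ‖13824000 * q ^ 3‖ ≤ 13824000 * (1 / 220 * ‖q‖ ^ 2) := by
    rw [norm_mul, norm_pow]
    norm_num only [RCLike.norm_ofNat]
    have : ‖q‖ ^ 3 ≤ 1 / 220 * ‖q‖ ^ 2 := by nlinarith [sq_nonneg ‖q‖]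
    linarith
  have t3 : ‖3 * (1 + 240 * q) ^ 2 * e‖ ≤ 3 * 2.1 ^ 2 * (4000 * ‖q‖ ^ 2) := by
    rw [norm_mul, norm_mul, norm_pow]
    norm_num only [RCLike.norm_ofNat]
    have : ‖1 + 240 * q‖ ^ 2 ≤ 2.1 ^ 2 := by gcongr
    gcongr
    linarith
  have t4 : ‖3 * (1 + 240 * q) * e ^ 2‖ ≤ 3 * 2.1 * (0.084 * (4000 * ‖q‖ ^ 2)) := by
    rw [norm_mul, norm_mul, norm_pow, pow_two ‖e‖]
    norm_num only [RCLike.norm_ofNat]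
    gcongr
    · linarith
    · linarith
  have t5 : ‖e ^ 3‖ ≤ 0.084 * (0.084 * (4000 * ‖q‖ ^ 2)) := by
    rw [norm_pow, pow_succ', pow_two]
    gcongr
  have t6 : ‖744 * q * (v - 24 * q)‖ ≤ 744 * ‖q‖ * (27 * ‖q‖) := by
    rw [norm_mul, norm_mul]
    norm_num only [RCLike.norm_ofNat]
    gcongr
    refine (norm_sub_le _ _).trans ?_
    rw [norm_mul]
    norm_num only [RCLike.norm_ofNat]
    linarith
  have hnum : ‖172800 * q ^ 2 + 13824000 * q ^ 3 + 3 * (1 + 240 * q) ^ 2 * e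
      + 3 * (1 + 240 * q) * e ^ 2 + e ^ 3 - v - 744 * q * (v - 24 * q)‖ ≤ 330000 * ‖q‖ ^ 2 := by
    refine (norm_sub_le_of_le (norm_sub_le_of_le (norm_add_le_of_le (norm_add_le_of_le
      (norm_add_le_of_le (norm_add_le_of_le t1.le t2) t3) t4) t5) hP) t6).trans ?_
    nlinarith [sq_nonneg ‖q‖]
  rw [key, norm_div, norm_mul, div_le_iff₀ (by positivity)]
  refine hnum.trans ?_
  nlinarith [sq_nonneg ‖q‖]

theorem norm_kleinJ_sub_le {τ : ℍ} (hτ : √3 / 2 ≤ τ.im) :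
    ‖kleinJ τ - 744 - (nome τ)⁻¹‖ ≤ 2000 :=
  (norm_kleinJ_sub_le_mul_norm_nome hτ).trans (by linarith [norm_nome_le hτ])

theorem norm_kleinJ_sub_const_le {τ : ℍ} (hτ : √3 / 2 ≤ τ.im) :
    ‖kleinJ τ - 744‖ ≤ 11 * Real.exp (2 * π * τ.im) := by
  have h1 := norm_kleinJ_sub_le hτ
  have h2 := norm_nome_le hτ
  have h3 : ‖(nome τ)⁻¹‖ = Real.exp (2 * π * τ.im) := by
    rw [norm_inv, norm_nome, Real.exp_neg, inv_inv]
  have h4 : 220 ≤ Real.exp (2 * π * τ.im) := by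
    rw [← h3, norm_inv]
    exact (le_inv_comm₀ (by norm_num) (norm_pos_iff.mpr (nome_ne_zero τ))).mpr (by simpa using h2)
  have : kleinJ τ - 744 = (kleinJ τ - 744 - (nome τ)⁻¹) + (nome τ)⁻¹ := by ring
  rw [this]
  refine (norm_add_le _ _).trans ?_
  rw [h3]
  linarith

theorem exists_smul_sqrt_three_le_im (τ : ℍ) : ∃ γ : SL(2, ℤ), √3 / 2 ≤ (γ • τ).im := by
  obtain ⟨γ, hγ⟩ := ModularGroup.exists_smul_mem_fd τ
  refine ⟨γ, ?_⟩
  have h := ModularGroup.three_le_four_mul_im_sq_of_mem_fd hγ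
  have h0 := (γ • τ).im_pos
  have : √3 ≤ 2 * (γ • τ).im := (Real.sqrt_le_left (by linarith)).mpr (by nlinarith)
  linarith

/-! ### The Hecke sum of `j - 744` -/

section Hecke

variable {n : ℕ} [NeZero n]

/-- An integral matrix of determinant `n ≠ 0` as an element of `GL₂(ℝ)`. -/
def toGLReal (B : FixedDetMatrix (Fin 2) ℤ (n : ℤ)) : GL (Fin 2) ℝ :=
  Matrix.GeneralLinearGroup.mkOfDetNeZero (B.1.map (Int.castRingHom ℝ)) <| by
    rw [← RingHom.mapMatrix_apply, ← RingHom.map_det, B.2]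
    simpa using NeZero.ne n

theorem toGLReal_apply (B : FixedDetMatrix (Fin 2) ℤ (n : ℤ)) (i j : Fin 2) :
    toGLReal B i j = (B.1 i j : ℝ) := rfl

theorem det_toGLReal (B : FixedDetMatrix (Fin 2) ℤ (n : ℤ)) :
    (toGLReal B).det.val = n := by
  change (B.1.map (Int.castRingHom ℝ)).det = n
  rw [← RingHom.mapMatrix_apply, ← RingHom.map_det, B.2]
  simp

theorem det_toGLReal_pos (B : FixedDetMatrix (Fin 2) ℤ (n : ℤ)) : 0 < (toGLReal B).det.val := by
  rw [det_toGLReal]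
  exact_mod_cast Nat.pos_of_ne_zero (NeZero.ne n)

theorem toGLReal_smul (γ : SL(2, ℤ)) (B : FixedDetMatrix (Fin 2) ℤ (n : ℤ)) :
    toGLReal (γ • B) = (γ : GL (Fin 2) ℝ) * toGLReal B := by
  ext i j
  rw [toGLReal_apply, FixedDetMatrices.smul_coe]
  simp [Matrix.mul_apply, toGLReal_apply]

theorem kleinJ_toGLReal_smul (γ : SL(2, ℤ)) (B : FixedDetMatrix (Fin 2) ℤ (n : ℤ)) (τ : ℍ) :
    kleinJ (toGLReal (γ • B) • τ) = kleinJ (toGLReal B • τ) := by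
  rw [toGLReal_smul, mul_smul]
  exact kleinJ_smul γ _

/-- Right multiplication of a matrix of determinant `n` by an element of `SL₂(ℤ)`. -/
def mulRight (B : FixedDetMatrix (Fin 2) ℤ (n : ℤ)) (γ : SL(2, ℤ)) :
    FixedDetMatrix (Fin 2) ℤ (n : ℤ) :=
  ⟨B.1 * γ.1, by rw [Matrix.det_mul, B.2, γ.2, mul_one]⟩

theorem toGLReal_mulRight (B : FixedDetMatrix (Fin 2) ℤ (n : ℤ)) (γ : SL(2, ℤ)) :
    toGLReal (mulRight B γ) = toGLReal B * (γ : GL (Fin 2) ℝ) := by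
  ext i j
  rw [toGLReal_apply]
  simp [mulRight, Matrix.mul_apply, toGLReal_apply]

variable (n) in
/-- The set of orbits of `SL₂(ℤ)` on the integral matrices of determinant `n`. -/
abbrev MatrixOrbit : Type :=
  MulAction.orbitRel.Quotient SL(2, ℤ) (FixedDetMatrix (Fin 2) ℤ (n : ℤ))

/-- The value of `j - 744` at the image of `τ` under an orbit of matrices. -/
def orbitValue (τ : ℍ) : MatrixOrbit n → ℂ :=
  Quotient.lift (fun B ↦ kleinJ (toGLReal B • τ) - 744) <| by
    rintro _ B ⟨γ, rfl⟩
    simp only [kleinJ_toGLReal_smul]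

/-- The permutation of the orbits induced by right multiplication. -/
def orbitMulRight (γ : SL(2, ℤ)) : MatrixOrbit n → MatrixOrbit n :=
  Quotient.map (fun B ↦ mulRight B γ) <| by
    rintro _ B ⟨δ, rfl⟩
    exact ⟨δ, Subtype.ext (Matrix.mul_assoc _ _ _).symm⟩

omit [NeZero n] in
theorem orbitMulRight_orbitMulRight (γ δ : SL(2, ℤ)) (x : MatrixOrbit n) :
    orbitMulRight γ (orbitMulRight δ x) = orbitMulRight (δ * γ) x := by
  induction x using Quotient.inductionOn with
  | h B =>
    refine congrArg (Quotient.mk _) (Subtype.ext ?_)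
    simp [mulRight, Matrix.mul_assoc]

omit [NeZero n] in
theorem orbitMulRight_one (x : MatrixOrbit n) : orbitMulRight 1 x = x := by
  induction x using Quotient.inductionOn with
  | h B =>
    refine congrArg (Quotient.mk _) (Subtype.ext ?_)
    simp [mulRight]

/-- Right multiplication as an equivalence. -/
def orbitEquiv (γ : SL(2, ℤ)) : MatrixOrbit n ≃ MatrixOrbit n where
  toFun := orbitMulRight γ
  invFun := orbitMulRight γ⁻¹
  left_inv x := by rw [orbitMulRight_orbitMulRight, mul_inv_cancel, orbitMulRight_one]
  right_inv x := by rw [orbitMulRight_orbitMulRight, inv_mul_cancel, orbitMulRight_one]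

theorem orbitValue_smul (γ : SL(2, ℤ)) (τ : ℍ) (x : MatrixOrbit n) :
    orbitValue (γ • τ) x = orbitValue τ (orbitEquiv γ x) := by
  induction x using Quotient.inductionOn with
  | h B =>
    change kleinJ (toGLReal B • γ • τ) - 744 = kleinJ (toGLReal (mulRight B γ) • τ) - 744
    rw [toGLReal_mulRight, mul_smul]
    rfl

variable (n) in
/-- The index set of the Hecke sum: pairs `(d, b)` with `d ∣ n` and `b < d`. -/
def heckeIndex : Finset (ℕ × ℕ) :=
  (n.divisors ×ˢ Finset.range n).filter fun p ↦ p.2 < p.1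

theorem mem_heckeIndex {p : ℕ × ℕ} : p ∈ heckeIndex n ↔ p.1 ∣ n ∧ p.2 < p.1 := by
  simp only [heckeIndex, Finset.mem_filter, Finset.mem_product, Nat.mem_divisors, Finset.mem_range]
  have := NeZero.ne n
  exact ⟨fun h ↦ ⟨h.1.1.1, h.2⟩, fun h ↦ ⟨⟨⟨h.1, this⟩,
    h.2.trans_le (Nat.le_of_dvd (Nat.pos_of_ne_zero this) h.1)⟩, h.2⟩⟩

omit [NeZero n] in
theorem card_heckeIndex_le : (heckeIndex n).card ≤ n ^ 2 :=
  (Finset.card_filter_le _ _).trans <| by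
    rw [Finset.card_product, Finset.card_range, pow_two]
    exact Nat.mul_le_mul_right _ (Nat.card_divisors_le_self n)

/-- The upper triangular matrix with diagonal `(n / d, d)` and upper right entry `b`. -/
def heckeMatrix (p : heckeIndex n) : FixedDetMatrix (Fin 2) ℤ (n : ℤ) :=
  ⟨!![((n / p.1.1 : ℕ) : ℤ), (p.1.2 : ℤ); 0, (p.1.1 : ℤ)], by
    rw [Matrix.det_fin_two_of, mul_zero, sub_zero, ← Nat.cast_mul,
      Nat.div_mul_cancel (mem_heckeIndex.mp p.2).1]⟩

theorem coe_heckeMatrix_smul (p : heckeIndex n) (τ : ℍ) :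
    ((toGLReal (heckeMatrix p) • τ : ℍ) : ℂ) = ((n / p.1.1 : ℕ) * τ + p.1.2) / p.1.1 := by
  rw [UpperHalfPlane.coe_smul_of_det_pos (det_toGLReal_pos _)]
  simp only [num, denom, toGLReal_apply]
  simp [heckeMatrix, -Int.natCast_ediv]

/-- An element of `SL₂(ℤ)` carrying one such matrix to another is upper triangular with diagonal 1,
so it fixes `d` and shifts `b` by a multiple of `d`. -/
theorem mk_heckeMatrix_injective :
    Function.Injective fun p : heckeIndex n ↦ (Quotient.mk _ (heckeMatrix p) : MatrixOrbit n) := by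
  rintro ⟨⟨d, b⟩, hp⟩ ⟨⟨d', b'⟩, hp'⟩ h
  obtain ⟨γ, hγ⟩ := Quotient.exact h
  have hm : γ.1 * (heckeMatrix ⟨(d', b'), hp'⟩).1 = (heckeMatrix ⟨(d, b), hp⟩).1 :=
    congrArg Subtype.val hγ
  have hdet := γ.det_coe
  rw [Matrix.det_fin_two] at hdet
  obtain ⟨h1, h2⟩ := mem_heckeIndex.mp hp
  obtain ⟨h1', h2'⟩ := mem_heckeIndex.mp hp'
  simp only at h1 h2 h1' h2'
  have ha' : (0 : ℤ) < ((n / d' : ℕ) : ℤ) := by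
    exact_mod_cast Nat.div_pos (Nat.le_of_dvd (Nat.pos_of_ne_zero (NeZero.ne n)) h1') (by omega)
  have e10 := congrFun (congrFun hm 1) 0
  have e11 := congrFun (congrFun hm 1) 1
  have e01 := congrFun (congrFun hm 0) 1
  simp only [heckeMatrix, Matrix.mul_apply, Fin.sum_univ_two, Matrix.of_apply, Matrix.cons_val',
    Matrix.cons_val_zero, Matrix.cons_val_one, Matrix.cons_val_fin_one, mul_zero, add_zero]
    at e10 e11 e01
  have h10 : γ 1 0 = 0 := (mul_eq_zero.mp e10).resolve_right ha'.ne'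
  rw [h10, mul_zero, sub_zero] at hdet
  rw [h10, zero_mul, zero_add] at e11
  have h11 : 0 < γ 1 1 := by
    by_contra hneg
    nlinarith [mul_nonneg (Int.natCast_nonneg d') (sub_nonneg.mpr (not_lt.mp hneg))]
  have h11' : γ 1 1 = 1 := Int.eq_one_of_dvd_one h11.le ⟨γ 0 0, by linarith⟩
  rw [h11', mul_one] at hdet
  rw [h11', one_mul] at e11
  rw [hdet, one_mul] at e01
  obtain rfl : d' = d := by exact_mod_cast e11
  have hb : b ≡ b' [MOD d'] := by
    rw [← Int.natCast_modEq_iff, ← e01]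
    exact (Int.modEq_iff_dvd.mpr ⟨-γ 0 1, by ring⟩)
  rw [Nat.ModEq, Nat.mod_eq_of_lt h2, Nat.mod_eq_of_lt h2'] at hb
  simp [hb]

theorem mk_heckeMatrix_surjective :
    Function.Surjective fun p : heckeIndex n ↦ (Quotient.mk _ (heckeMatrix p) : MatrixOrbit n) := by
  intro x
  induction x using Quotient.inductionOn with
  | h B =>
    have hstep (γ : SL(2, ℤ)) (B : FixedDetMatrix (Fin 2) ℤ (n : ℤ)) :
        (Quotient.mk _ (γ • B) : MatrixOrbit n) = Quotient.mk _ B := Quotient.sound ⟨γ, rfl⟩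
    refine FixedDetMatrices.induction_on (C := fun B ↦ ∃ p : heckeIndex n,
      (Quotient.mk _ (heckeMatrix p) : MatrixOrbit n) = Quotient.mk _ B)
      (by exact_mod_cast NeZero.ne n) (fun B hc ha hb hbd ↦ ?_)
      (fun B hB ↦ by rwa [hstep]) (fun B hB ↦ by rwa [hstep])
    have hdet := B.2
    rw [Matrix.det_fin_two, hc, mul_zero, sub_zero] at hdet
    have hn : (0 : ℤ) < n := by exact_mod_cast Nat.pos_of_ne_zero (NeZero.ne n)
    have hd : 0 < B.1 1 1 := by
      by_contra hneg
      nlinarith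
    obtain ⟨a, ha'⟩ := Int.eq_ofNat_of_zero_le ha.le
    obtain ⟨b, hb'⟩ := Int.eq_ofNat_of_zero_le hb
    obtain ⟨d, hd'⟩ := Int.eq_ofNat_of_zero_le hd.le
    rw [ha', hd'] at hdet
    have had : a * d = n := by exact_mod_cast hdet
    rw [abs_of_nonneg hb, abs_of_pos hd, hb', hd'] at hbd
    have hd0 : 0 < d := by omega
    refine ⟨⟨(d, b), mem_heckeIndex.mpr ⟨⟨a, by rw [← had, mul_comm]⟩, by exact_mod_cast hbd⟩⟩, ?_⟩
    congr 1
    refine Subtype.ext (Matrix.ext fun i j ↦ ?_)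
    have hna : n / d = a := by rw [← had, Nat.mul_div_cancel _ hd0]
    fin_cases i <;> fin_cases j <;> simp [heckeMatrix, ha', hb', hc, hd', hna]

variable (n) in
/-- The Hecke sum `∑_{ad = n, 0 ≤ b < d} (j - 744)((aτ + b)/d)`. -/
def heckeSum (τ : ℍ) : ℂ :=
  ∑ p : heckeIndex n, (kleinJ (toGLReal (heckeMatrix p) • τ) - 744)

/-- The Hecke matrices represent each left `SL₂(ℤ)`-orbit once. Written over orbits, the sum is
visibly invariant, since `τ ↦ γτ` permutes the orbits by right multiplication. -/
theorem heckeSum_eq_finsum (τ : ℍ) : heckeSum n τ = ∑ᶠ x : MatrixOrbit n, orbitValue τ x := by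
  rw [← finsum_comp_equiv (Equiv.ofBijective _
    ⟨mk_heckeMatrix_injective (n := n), mk_heckeMatrix_surjective⟩), finsum_eq_sum_of_fintype]
  rfl

theorem heckeSum_smul (γ : SL(2, ℤ)) (τ : ℍ) : heckeSum n (γ • τ) = heckeSum n τ := by
  rw [heckeSum_eq_finsum, heckeSum_eq_finsum]
  exact (finsum_congr fun x ↦ orbitValue_smul γ τ x).trans (finsum_comp_equiv (orbitEquiv γ))

theorem mdifferentiable_heckeSum : MDifferentiable 𝓘(ℂ) 𝓘(ℂ) (heckeSum n) := by
  have h (s : Finset (heckeIndex n)) : MDifferentiable 𝓘(ℂ) 𝓘(ℂ)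
      fun τ ↦ ∑ p ∈ s, (kleinJ (toGLReal (heckeMatrix p) • τ) - 744) := by
    classical
    induction s using Finset.induction_on with
    | empty => simpa using mdifferentiable_const
    | insert p s hp ih =>
      simp only [Finset.sum_insert hp]
      have hp := mdifferentiable_kleinJ.comp (UpperHalfPlane.mdifferentiable_smul
        (det_toGLReal_pos (heckeMatrix p)))
      exact (hp.sub mdifferentiable_const).add ih
  exact h _

theorem tendsto_kleinJ_sub : Tendsto (fun τ ↦ kleinJ τ - 744 - (nome τ)⁻¹) atImInfty (𝓝 0) := by
  have h : Tendsto (fun τ ↦ 400000 * ‖nome τ‖) atImInfty (𝓝 0) := by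
    simpa using tendsto_nome.norm.const_mul 400000
  refine squeeze_zero_norm' ?_ h
  filter_upwards [(UpperHalfPlane.atImInfty_mem _).mpr ⟨√3 / 2, fun τ hτ ↦ hτ⟩] with τ hτ
  exact norm_kleinJ_sub_le_mul_norm_nome hτ

theorem tendsto_toGLReal_heckeMatrix_smul (p : heckeIndex n) :
    Tendsto (fun τ ↦ toGLReal (heckeMatrix p) • τ) atImInfty atImInfty :=
  UpperHalfPlane.tendsto_smul_atImInfty (by
    rw [toGLReal_apply]
    simp [heckeMatrix])

theorem sum_range_cexp (d : ℕ) (hd : 1 < d) (z : ℂ) :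
    ∑ b ∈ Finset.range d, cexp (-(2 * π * Complex.I * ((z + b) / d))) = 0 := by
  have hd0 : (d : ℂ) ≠ 0 := by exact_mod_cast (by omega : d ≠ 0)
  have hζ := (Complex.isPrimitiveRoot_exp d (by omega)).inv
  have h (b : ℕ) : cexp (-(2 * π * Complex.I * ((z + b) / d))) =
      cexp (-(2 * π * Complex.I * (z / d))) * (cexp (2 * π * Complex.I / d))⁻¹ ^ b := by
    rw [← Complex.exp_neg, ← Complex.exp_nat_mul, ← Complex.exp_add]
    congr 1
    field_simp
    ring
  rw [Finset.sum_congr rfl fun b _ ↦ h b, ← Finset.mul_sum, hζ.geom_sum_eq_zero hd, mul_zero]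

/-- For fixed `d > 1` the sum over `b` is a multiple of the sum of all `d`-th roots of unity, which
is zero; only `d = 1` survives. -/
theorem sum_nome_inv (τ : ℍ) :
    ∑ p : heckeIndex n, (nome (toGLReal (heckeMatrix p) • τ))⁻¹ = nome τ ^ (-(n : ℤ)) := by
  have h (p : heckeIndex n) : (nome (toGLReal (heckeMatrix p) • τ))⁻¹ =
      cexp (-(2 * π * Complex.I * (((n / p.1.1 : ℕ) * τ + p.1.2) / p.1.1))) := by
    rw [nome, coe_heckeMatrix_smul, Complex.exp_neg]
  rw [Finset.sum_congr rfl fun p _ ↦ h p, Finset.sum_coe_sort (heckeIndex n) fun p : ℕ × ℕ ↦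
    cexp (-(2 * π * Complex.I * (((n / p.1 : ℕ) * τ + p.2) / p.1))),
    Finset.sum_finset_product _ n.divisors Finset.range fun p ↦ by
      rw [mem_heckeIndex, Nat.mem_divisors, Finset.mem_range]
      simp [NeZero.ne n]]
  rw [Finset.sum_eq_single 1]
  · simp only [Finset.range_one, Finset.sum_singleton, Nat.div_one, Nat.cast_zero, add_zero,
      Nat.cast_one, div_one]
    rw [nome, ← Complex.exp_int_mul]
    congr 1
    push_cast
    ring
  · intro d hd hd1
    have := Nat.pos_of_mem_divisors hd
    have := sum_range_cexp d (by omega) ((n / d : ℕ) * τ)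
    simpa only using this
  · simp [NeZero.ne n]

theorem tendsto_heckeSum_sub :
    Tendsto (fun τ ↦ heckeSum n τ - nome τ ^ (-(n : ℤ))) atImInfty (𝓝 0) := by
  have h := tendsto_finsetSum (Finset.univ : Finset (heckeIndex n))
    fun p _ ↦ tendsto_kleinJ_sub.comp (tendsto_toGLReal_heckeMatrix_smul p)
  simp only [Finset.sum_const_zero] at h
  refine h.congr fun τ ↦ ?_
  simp only [Function.comp_apply]
  rw [Finset.sum_sub_distrib, sum_nome_inv, heckeSum]

/-- Both sides are invariant and `q⁻ⁿ + o(1)`, so their difference vanishes at the cusp. Subtracting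
744 in each summand removes the constant term. -/
theorem aeval_kleinJ_faberPolynomial (τ : ℍ) :
    Polynomial.aeval (kleinJ τ) (faberPolynomial n) = heckeSum n τ := by
  have h := eq_zero_of_tendsto_zero
    (f := fun τ ↦ Polynomial.aeval (kleinJ τ) (faberPolynomial n) - heckeSum n τ)
    ((mdifferentiable_aeval_kleinJ _).sub mdifferentiable_heckeSum)
    (fun γ τ ↦ by rw [kleinJ_smul, heckeSum_smul]) ?_
  · exact sub_eq_zero.mp (congrFun h τ)
  · have h1 := (isFaberPolynomial_faberPolynomial n).isBigO.trans_tendsto tendsto_nome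
    simpa using h1.sub (tendsto_heckeSum_sub (n := n))

end Hecke

/-! ### The size of the Faber polynomials on the unit circle -/

/-- The form is `|pτ + s|²` for `|τ| = 1`, `Re τ = x`. Apart from 0, the excluded vectors are those
where it equals 1 or `2 - 2x`. It is at least `p² + s²` when `ps ≥ 0`, and at least `p² + ps + s²`
when `ps < 0`, because `2x ≤ 1`. -/
theorem two_le_quadForm {x : ℝ} (hx0 : 0 ≤ x) (hx1 : x ≤ 1 / 2) {p s : ℤ}
    (h0 : ¬(p = 0 ∧ s = 0)) (h1 : ¬(p = 0 ∧ s ^ 2 = 1)) (h2 : ¬(p ^ 2 = 1 ∧ s = 0))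
    (h3 : ¬(p ^ 2 = 1 ∧ s = -p)) : 2 ≤ (p : ℝ) ^ 2 + 2 * x * p * s + (s : ℝ) ^ 2 := by
  have hsq {m : ℤ} (hm : m ≠ 0) : 1 ≤ m ^ 2 := by
    have : 0 < m ^ 2 := by positivity
    omega
  rcases le_or_gt 0 (p * s) with h | h
  · have key : 2 ≤ p ^ 2 + s ^ 2 := by
      by_cases hp : p = 0
      · have hs : s ≠ 0 := fun hs ↦ h0 ⟨hp, hs⟩
        have := hsq hs
        have : s ^ 2 ≠ 1 := fun h ↦ h1 ⟨hp, h⟩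
        rw [hp]
        omega
      · by_cases hs : s = 0
        · have := hsq hp
          have : p ^ 2 ≠ 1 := fun h ↦ h2 ⟨h, hs⟩
          rw [hs]
          omega
        · linarith [hsq hp, hsq hs]
    have key' : (2 : ℝ) ≤ (p : ℝ) ^ 2 + (s : ℝ) ^ 2 := by exact_mod_cast key
    have h' : (0 : ℝ) ≤ (p : ℝ) * s := by exact_mod_cast h
    nlinarith [mul_nonneg hx0 h']
  · have key : 2 ≤ p ^ 2 + p * s + s ^ 2 := by
      by_cases hps : s = -p
      · have hp : p ≠ 0 := by
          rintro rfl
          simp at h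
        have := hsq hp
        have : p ^ 2 ≠ 1 := fun h ↦ h3 ⟨h, hps⟩
        have e : p ^ 2 + p * s + s ^ 2 = p ^ 2 := by rw [hps]; ring
        omega
      · have := hsq (m := p + s) (by omega)
        nlinarith
    have key' : (2 : ℝ) ≤ (p : ℝ) ^ 2 + p * s + (s : ℝ) ^ 2 := by exact_mod_cast key
    have h' : (p : ℝ) * s ≤ 0 := by exact_mod_cast h.le
    nlinarith [mul_nonneg (sub_nonneg.mpr hx1) (neg_nonneg.mpr h')]

theorem normSq_linear (τ : ℍ) (hτ : ‖(τ : ℂ)‖ = 1) (p s : ℝ) :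
    Complex.normSq (p * τ + s) = p ^ 2 + 2 * τ.re * p * s + s ^ 2 := by
  have h : τ.re ^ 2 + τ.im ^ 2 = 1 := by
    have := Complex.sq_norm (τ : ℂ)
    rw [hτ, Complex.normSq_apply] at this
    simp only [UpperHalfPlane.coe_re, UpperHalfPlane.coe_im] at this
    linarith
  rw [Complex.normSq_apply]
  simp
  linear_combination p ^ 2 * h

section HeckeBound

variable {n : ℕ} [NeZero n]

/-- The height is `ny/|pτ + s|²`, where `(p, s)` is the bottom row of `γ` times the Hecke matrix. A
short bottom row occurs only for the three excluded indices. -/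
theorem im_smul_heckeMatrix_smul_le {τ : ℍ} (hτ : ‖(τ : ℂ)‖ = 1) (hx0 : 0 ≤ τ.re)
    (hx1 : τ.re ≤ 1 / 2) (p : heckeIndex n) (h1 : p.1 ≠ (1, 0)) (h2 : p.1 ≠ (n, 0))
    (h3 : p.1 ≠ (n, n - 1)) (γ : SL(2, ℤ)) :
    (γ • toGLReal (heckeMatrix p) • τ).im ≤ n * τ.im / 2 := by
  obtain ⟨⟨d, b⟩, hp⟩ := p
  obtain ⟨⟨a, had⟩, hbd⟩ := mem_heckeIndex.mp hp
  simp only at had hbd h1 h2 h3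
  have hn := Nat.pos_of_ne_zero (NeZero.ne n)
  have hd0 : 0 < d := by omega
  have ha0 : 0 < a := by
    rcases Nat.eq_zero_or_pos a with rfl | h
    · omega
    · exact h
  have hna : n / d = a := by rw [had, Nat.mul_div_cancel_left _ hd0]
  set B := γ • heckeMatrix ⟨(d, b), hp⟩ with hB
  have hsmul : γ • toGLReal (heckeMatrix ⟨(d, b), hp⟩) • τ = toGLReal B • τ := by
    rw [hB, toGLReal_smul, mul_smul]
    rfl
  have hBm : B.1 = γ.1 * (heckeMatrix ⟨(d, b), hp⟩).1 := rfl
  have hB10 : B.1 1 0 = γ 1 0 * a := by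
    simp [hBm, heckeMatrix, Matrix.mul_apply, Fin.sum_univ_two, -Int.natCast_ediv, hna]
  have hB11 : B.1 1 1 = γ 1 0 * b + γ 1 1 * d := by
    simp [hBm, heckeMatrix, Matrix.mul_apply, Fin.sum_univ_two]
  have hdet := γ.det_coe
  rw [Matrix.det_fin_two] at hdet
  have haZ : (0 : ℤ) < a := by exact_mod_cast ha0
  have hdZ : (0 : ℤ) < d := by exact_mod_cast hd0
  have ha_one (h : (γ 1 0 * a) ^ 2 = 1) : a = 1 := by
    have : (a : ℤ) = 1 := Int.eq_one_of_dvd_one haZ.le ⟨γ 1 0 ^ 2 * a, by linear_combination -h⟩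
    exact_mod_cast this
  have key : (2 : ℝ) ≤ ((B.1 1 0 : ℤ) : ℝ) ^ 2 + 2 * τ.re * (B.1 1 0 : ℤ) * (B.1 1 1 : ℤ) +
      ((B.1 1 1 : ℤ) : ℝ) ^ 2 := by
    rw [hB10, hB11]
    -- The row `(0, 0)` contradicts `det γ = 1`; the rows `(0, ±1)`, `(±1, 0)`, `±(1, -1)` force
    -- `(d, b)` to be `(1, 0)`, `(n, 0)`, `(n, n - 1)` respectively.
    refine two_le_quadForm hx0 hx1 ?_ ?_ ?_ ?_
    · rintro ⟨e1, e2⟩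
      have h10 : γ 1 0 = 0 := (mul_eq_zero.mp e1).resolve_right haZ.ne'
      rw [h10, zero_mul, zero_add] at e2
      rw [h10, (mul_eq_zero.mp e2).resolve_right hdZ.ne'] at hdet
      simp at hdet
    · rintro ⟨e1, e2⟩
      have h10 : γ 1 0 = 0 := (mul_eq_zero.mp e1).resolve_right haZ.ne'
      rw [h10, zero_mul, zero_add] at e2
      have : (d : ℤ) = 1 := Int.eq_one_of_dvd_one hdZ.le ⟨γ 1 1 ^ 2 * d, by linear_combination -e2⟩
      have hd1 : d = 1 := by exact_mod_cast this
      exact h1 (by rw [hd1, show b = 0 by omega])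
    · rintro ⟨e1, e2⟩
      have ha1 := ha_one e1
      rw [ha1, Nat.cast_one, mul_one] at e1
      have hdvd : (d : ℤ) ∣ b := ⟨-(γ 1 0 * γ 1 1), by linear_combination γ 1 0 * e2 - b * e1⟩
      have hb : b = 0 := Nat.eq_zero_of_dvd_of_lt (by exact_mod_cast hdvd) hbd
      exact h2 (by rw [hb, had, ha1, mul_one])
    · rintro ⟨e1, e2⟩
      have ha1 := ha_one e1
      rw [ha1, Nat.cast_one, mul_one] at e1 e2
      have hdvd : (d : ℤ) ∣ (b + 1 : ℕ) := ⟨-(γ 1 0 * γ 1 1), by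
        push_cast
        linear_combination γ 1 0 * e2 - (b + 1) * e1⟩
      have hb : d ≤ b + 1 := Nat.le_of_dvd (by omega) (by exact_mod_cast hdvd)
      exact h3 (by rw [had, ha1, mul_one, show b = d - 1 by omega])
  have hden : Complex.normSq (denom (toGLReal B) τ) = ((B.1 1 0 : ℤ) : ℝ) ^ 2 +
      2 * τ.re * (B.1 1 0 : ℤ) * (B.1 1 1 : ℤ) + ((B.1 1 1 : ℤ) : ℝ) ^ 2 := by
    rw [← normSq_linear τ hτ]
    rfl
  rw [hsmul, UpperHalfPlane.im_smul_eq_div_normSq, det_toGLReal, hden, Nat.abs_cast]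
  have := τ.im_pos
  gcongr

/-- The approximation `j ≈ 744 + 1/q` is applied at an equivalent point `z` that lies high enough,
not at `w` itself. -/
theorem norm_kleinJ_sub_cexp_le {w : ℍ} (γ : SL(2, ℤ)) {z : ℂ} (hz : ((γ • w : ℍ) : ℂ) = z)
    (h : √3 / 2 ≤ z.im) : ‖kleinJ w - 744 - cexp (-(2 * π * Complex.I * z))‖ ≤ 2000 := by
  have := norm_kleinJ_sub_le (τ := γ • w) (by rw [← UpperHalfPlane.coe_im, hz]; exact h)
  rwa [kleinJ_smul, nome, hz, ← Complex.exp_neg] at this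

/-- The three dominant terms of the Hecke sum on the unit circle. -/
def heckeMain (n : ℕ) (τ : ℍ) (p : ℕ × ℕ) : ℂ :=
  (if p = (1, 0) then cexp (-(2 * π * Complex.I * (n * τ))) else 0) +
  (if p = (n, 0) then cexp (-(2 * π * Complex.I * (n * (-(starRingEnd ℂ) (τ : ℂ))))) else 0) +
  (if p = (n, n - 1) then
    cexp (-(2 * π * Complex.I * (n * (1 / 2 + (τ.im / (2 - 2 * τ.re) : ℝ) * Complex.I)))) else 0)

theorem sum_heckeMain (hn : 2 ≤ n) (τ : ℍ) :
    ∑ p : heckeIndex n, heckeMain n τ p =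
      Real.exp (2 * π * n * τ.im) * (2 * Real.cos (2 * π * n * τ.re) : ℝ) +
        (-1) ^ n * Real.exp (2 * π * n * (τ.im / (2 - 2 * τ.re))) := by
  have hne : n ≠ 0 := NeZero.ne n
  have m1 : (1, 0) ∈ heckeIndex n := mem_heckeIndex.mpr ⟨one_dvd n, one_pos⟩
  have m2 : (n, 0) ∈ heckeIndex n := mem_heckeIndex.mpr ⟨dvd_rfl, by omega⟩
  have m3 : (n, n - 1) ∈ heckeIndex n := mem_heckeIndex.mpr ⟨dvd_rfl, by simp; omega⟩
  rw [Finset.sum_coe_sort (heckeIndex n) (heckeMain n τ)]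
  simp only [heckeMain, Finset.sum_add_distrib, Finset.sum_ite_eq', m1, m2, m3, if_true]
  have hτ : (τ : ℂ) = τ.re + τ.im * Complex.I := (Complex.re_add_im (τ : ℂ)).symm
  have hpi : cexp (-(π * Complex.I)) = -1 := by rw [Complex.exp_neg, Complex.exp_pi_mul_I]; norm_num
  congr 1
  · rw [hτ]
    push_cast [Complex.cos]
    rw [mul_div_cancel₀ _ (two_ne_zero' ℂ), mul_add (cexp _), ← Complex.exp_add,
      ← Complex.exp_add, add_comm]
    congr 2
    · simp only [map_add, map_mul, Complex.conj_ofReal, Complex.conj_I]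
      linear_combination (2 * π * n * τ.im : ℂ) * (-Complex.I_sq)
    · linear_combination (2 * π * n * τ.im : ℂ) * (-Complex.I_sq)
  · rw [← hpi, ← Complex.exp_nat_mul, Complex.ofReal_exp, ← Complex.exp_add]
    congr 1
    push_cast
    linear_combination (2 * π * n * (τ.im / (2 - 2 * τ.re)) : ℂ) * (-Complex.I_sq)

theorem inv_one_sub_coe {τ : ℍ} (hτ : ‖(τ : ℂ)‖ = 1) (hx1 : τ.re ≤ 1 / 2) :
    (1 - (τ : ℂ))⁻¹ = 1 / 2 + (τ.im / (2 - 2 * τ.re) : ℝ) * Complex.I := by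
  have h := normSq_linear τ hτ 1 0
  rw [Complex.normSq_apply] at h
  simp at h
  have h2 : (1 - τ.re : ℂ) ≠ 0 := by
    have : 1 - τ.re ≠ 0 := by linarith
    exact_mod_cast this
  have h' : (τ.re * τ.re + τ.im * τ.im : ℂ) = 1 := by exact_mod_cast h
  refine inv_eq_of_mul_eq_one_right ?_
  rw [← Complex.re_add_im (τ : ℂ), UpperHalfPlane.coe_re, UpperHalfPlane.coe_im]
  push_cast
  rw [show (2 - 2 * τ.re : ℂ) = 2 * (1 - τ.re) by ring]
  field_simp
  linear_combination h' - (τ.im : ℂ) ^ 2 * Complex.I_sq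

theorem sqrt_three_div_two_le_im {τ : ℍ} (hτ : ‖(τ : ℂ)‖ = 1) (hx0 : 0 ≤ τ.re)
    (hx1 : τ.re ≤ 1 / 2) : √3 / 2 ≤ τ.im := by
  have h := normSq_linear τ hτ 1 0
  rw [Complex.normSq_apply] at h
  simp at h
  have h0 := τ.im_pos
  have : √3 ≤ 2 * τ.im := (Real.sqrt_le_left (by linarith)).mpr (by nlinarith)
  linarith

/-- The condition `n ≥ 2` keeps the three dominant indices distinct. Their representatives are
reached by `1`, `S` and `S T⁻¹`; all other summands are bounded through their height. -/
theorem norm_kleinJ_sub_heckeMain_le (hn : 2 ≤ n) {τ : ℍ} (hτ : ‖(τ : ℂ)‖ = 1) (hx0 : 0 ≤ τ.re)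
    (hx1 : τ.re ≤ 1 / 2) (p : heckeIndex n) :
    ‖kleinJ (toGLReal (heckeMatrix p) • τ) - 744 - heckeMain n τ p‖ ≤
      11 * Real.exp (π * n * τ.im) := by
  have hy := sqrt_three_div_two_le_im hτ hx0 hx1
  have hn' : (2 : ℝ) ≤ n := by exact_mod_cast hn
  have hn0 : (n : ℂ) ≠ 0 := by exact_mod_cast (by omega : n ≠ 0)
  have hy0 := τ.im_pos
  -- `11 · 220 = 2420`, so the error 2000 of a dominant term fits the common bound.
  have hexp : 2000 ≤ 11 * Real.exp (π * n * τ.im) := by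
    have : Real.exp (π * √3) ≤ Real.exp (π * n * τ.im) := by
      rw [Real.exp_le_exp, mul_assoc]
      gcongr
      nlinarith
    linarith [two_twenty_le_exp]
  by_cases h1 : p.1 = (1, 0)
  · have hm : heckeMain n τ p = cexp (-(2 * π * Complex.I * (n * τ))) := by
      rw [heckeMain, if_pos h1, if_neg, if_neg, add_zero, add_zero]
      · rw [h1]
        simp
        omega
      · rw [h1]
        simp
        omega
    rw [hm]
    refine (norm_kleinJ_sub_cexp_le 1 ?_ ?_).trans hexp
    · rw [one_smul, coe_heckeMatrix_smul, h1]
      simp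
    · simp
      nlinarith
  by_cases h2 : p.1 = (n, 0)
  · have hm : heckeMain n τ p =
        cexp (-(2 * π * Complex.I * (n * (-(starRingEnd ℂ) (τ : ℂ))))) := by
      rw [heckeMain, if_neg h1, if_pos h2, if_neg, zero_add, add_zero]
      rw [h2]
      simp
      omega
    rw [hm]
    refine (norm_kleinJ_sub_cexp_le ModularGroup.S ?_ ?_).trans hexp
    · rw [coe_S_smul, coe_heckeMatrix_smul, h2, ← Complex.inv_eq_conj hτ]
      have := τ.ne_zero
      simp only [Nat.div_self (by omega : 0 < n), Nat.cast_one, Nat.cast_zero, one_mul, add_zero]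
      field_simp
    · simp
      nlinarith
  by_cases h3 : p.1 = (n, n - 1)
  · have hm : heckeMain n τ p = cexp (-(2 * π * Complex.I *
        (n * (1 / 2 + (τ.im / (2 - 2 * τ.re) : ℝ) * Complex.I)))) := by
      rw [heckeMain, if_neg h1, if_neg h2, if_pos h3, zero_add, zero_add]
    rw [hm]
    refine (norm_kleinJ_sub_cexp_le (ModularGroup.S * ModularGroup.T⁻¹) ?_ ?_).trans hexp
    -- `T⁻¹` moves `(τ + n - 1)/n` to `(τ - 1)/n`, and `S` sends this to `n/(1 - τ)`.
    · have hn1 : ((n - 1 : ℕ) : ℂ) = n - 1 := by rw [Nat.cast_sub (by omega), Nat.cast_one]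
      rw [mul_smul, coe_S_smul, ← zpow_neg_one ModularGroup.T, UpperHalfPlane.modular_T_zpow_smul,
        UpperHalfPlane.coe_vadd, coe_heckeMatrix_smul, h3, ← inv_one_sub_coe hτ hx1, ← inv_neg,
        ← inv_inv (n : ℂ), ← mul_inv]
      simp only [Nat.div_self (by omega : 0 < n), Nat.cast_one, hn1]
      congr 1
      field_simp
      push_cast
      ring
    · have hd : τ.im / 2 ≤ τ.im / (2 - 2 * τ.re) :=
        div_le_div_of_nonneg_left hy0.le (by linarith) (by linarith)
      have him : (n * (1 / 2 + (τ.im / (2 - 2 * τ.re) : ℝ) * Complex.I) : ℂ).im =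
          n * (τ.im / (2 - 2 * τ.re)) := by
        generalize τ.im / (2 - 2 * τ.re) = c
        simp
      rw [him]
      nlinarith
  · have hm : heckeMain n τ p = 0 := by
      rw [heckeMain, if_neg h1, if_neg h2, if_neg h3, zero_add, zero_add]
    rw [hm, sub_zero]
    obtain ⟨γ, hγ⟩ := exists_smul_sqrt_three_le_im (toGLReal (heckeMatrix p) • τ)
    rw [← kleinJ_smul γ]
    refine (norm_kleinJ_sub_const_le hγ).trans ?_
    have := im_smul_heckeMatrix_smul_le hτ hx0 hx1 p h1 h2 h3 γ
    gcongr 11 * Real.exp ?_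
    nlinarith [Real.pi_pos]

theorem norm_aeval_faberPolynomial_sub_le (hn : 2 ≤ n) {τ : ℍ} (hτ : ‖(τ : ℂ)‖ = 1)
    (hx0 : 0 ≤ τ.re) (hx1 : τ.re ≤ 1 / 2) :
    ‖Polynomial.aeval (kleinJ τ) (faberPolynomial n) -
      (Real.exp (2 * π * n * τ.im) * (2 * Real.cos (2 * π * n * τ.re) : ℝ) +
        (-1) ^ n * Real.exp (2 * π * n * (τ.im / (2 - 2 * τ.re))))‖ ≤
      1 / 2 * Real.exp (2 * π * n * τ.im) := by
  rw [aeval_kleinJ_faberPolynomial, ← sum_heckeMain hn, heckeSum, ← Finset.sum_sub_distrib]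
  refine (norm_sum_le_of_le _ fun p _ ↦ norm_kleinJ_sub_heckeMain_le hn hτ hx0 hx1 p).trans ?_
  rw [Finset.sum_const, nsmul_eq_mul, Finset.card_univ, Fintype.card_coe]
  have hc : ((heckeIndex n).card : ℝ) ≤ (n : ℝ) ^ 2 := by exact_mod_cast card_heckeIndex_le
  have hy := sqrt_three_div_two_le_im hτ hx0 hx1
  have hE : Real.exp (2 * π * n * τ.im) = Real.exp (π * n * τ.im) * Real.exp (π * n * τ.im) := by
    rw [← Real.exp_add]
    ring_nf
  have h14 : (14 : ℝ) ^ n ≤ Real.exp (π * n * τ.im) := by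
    have h1 : (14 : ℝ) ≤ Real.exp (π * τ.im) := by
      have h2 : Real.exp (π * √3) ≤ Real.exp (π * τ.im) ^ 2 := by
        rw [← Real.exp_nat_mul, Real.exp_le_exp]
        push_cast
        nlinarith [Real.pi_pos]
      exact le_of_sq_le_sq (by linarith [two_twenty_le_exp]) (Real.exp_pos _).le
    calc (14 : ℝ) ^ n ≤ Real.exp (π * τ.im) ^ n := by gcongr
      _ = _ := by rw [← Real.exp_nat_mul]; ring_nf
  -- There are at most `n²` errors of size `11U`, with `U = e^{πny} ≥ 14ⁿ`; the sum is at most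
  -- `U²/2` once `22n² ≤ U`.
  have h48 : 48 * (n : ℝ) ^ 2 ≤ 14 ^ n := by
    clear * - hn
    induction n, hn using Nat.le_induction with
    | base => norm_num
    | succ m hm ih =>
      have : (2 : ℝ) ≤ m := by exact_mod_cast hm
      rw [pow_succ (14 : ℝ)]
      push_cast
      nlinarith
  rw [hE]
  set U := Real.exp (π * n * τ.im)
  have hU : 0 < U := Real.exp_pos _
  calc ((heckeIndex n).card : ℝ) * (11 * U) ≤ (n : ℝ) ^ 2 * (11 * U) := by gcongr
    _ ≤ 1 / 2 * (U * U) := by nlinarith [sq_nonneg (n : ℝ)]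

end HeckeBound

/-! ### The associated modular functions -/

theorem faberPolynomial_natDegree (n : ℕ) : (faberPolynomial n).natDegree = n :=
  (isFaberPolynomial_faberPolynomial n).natDegree_eq

theorem faberPolynomial_monic (n : ℕ) : (faberPolynomial n).Monic :=
  (isFaberPolynomial_faberPolynomial n).monic

theorem natDegree_faberCombination (A : ℝ⟦X⟧) {k : ℕ} (hk : 1 ≤ k) :
    (faberCombination A k).natDegree = k := by
  have hdeg (n : ℕ) : ((faberPolynomial n).map (Int.castRingHom ℝ)).natDegree = n := by
    rw [(faberPolynomial_monic n).natDegree_map, faberPolynomial_natDegree]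
  rw [faberCombination, Polynomial.natDegree_add_eq_left_of_natDegree_lt, hdeg]
  rw [hdeg]
  refine (Polynomial.natDegree_sum_le_of_forall_le (n := k - 1) _ _ fun n hn ↦ ?_).trans_lt
    (by omega)
  have := Finset.mem_range.mp hn
  exact (Polynomial.natDegree_C_mul_le _ _).trans (by rw [hdeg]; omega)

theorem aeval_faberCombination {A : ℝ⟦X⟧} (hA : PowerSeries.constantCoeff A = 1) (k : ℕ) (z : ℂ) :
    Polynomial.aeval z (faberCombination A k) = ∑ n ∈ Finset.range (k + 1),
      ((PowerSeries.coeff (k - n) A : ℝ) : ℂ) * Polynomial.aeval z (faberPolynomial n) := by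
  have hmap (F : ℤ[X]) : Polynomial.aeval z (F.map (Int.castRingHom ℝ)) = Polynomial.aeval z F :=
    Polynomial.aeval_map_algebraMap ℝ z F
  rw [faberCombination, Finset.sum_range_succ, add_comm]
  simp only [map_add, map_sum, map_mul, hmap, Polynomial.aeval_C, Nat.sub_self,
    PowerSeries.coeff_zero_eq_constantCoeff, hA, Complex.coe_algebraMap, Complex.ofReal_one,
    one_mul]

theorem eval_faberCombination {A : ℝ⟦X⟧} (k : ℕ) (y : ℝ) :
    (faberCombination A k).eval y = Polynomial.aeval y (faberPolynomial k) +
      ∑ n ∈ Finset.range k,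
        PowerSeries.coeff (k - n) A * Polynomial.aeval y (faberPolynomial n) := by
  simp [faberCombination, Polynomial.eval_finsetSum, Polynomial.eval_map,
    Polynomial.aeval_def]

theorem isBigO_aeval_faberCombination_sub {A : ℝ⟦X⟧} (hA : PowerSeries.constantCoeff A = 1)
    (k : ℕ) :
    (fun τ ↦ Polynomial.aeval (kleinJ τ) (faberCombination A k) - ∑ n ∈ Finset.range (k + 1),
      ((PowerSeries.coeff n A : ℝ) : ℂ) * nome τ ^ ((n : ℤ) - (k : ℤ))) =O[atImInfty] nome := by
  have h : (fun τ ↦ ∑ n ∈ Finset.range (k + 1), ((PowerSeries.coeff (k - n) A : ℝ) : ℂ) *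
      (Polynomial.aeval (kleinJ τ) (faberPolynomial n) - nome τ ^ (-(n : ℤ)))) =O[atImInfty] nome :=
    .fun_sum fun n _ ↦ (isFaberPolynomial_faberPolynomial n).isBigO.const_mul_left _
  refine h.congr_left fun τ ↦ ?_
  rw [aeval_faberCombination hA, ← Finset.sum_range_reflect (fun n : ℕ ↦
    ((PowerSeries.coeff n A : ℝ) : ℂ) * nome τ ^ ((n : ℤ) - (k : ℤ))), ← Finset.sum_sub_distrib]
  refine Finset.sum_congr rfl fun n hn ↦ ?_
  have := Finset.mem_range.mp hn
  rw [mul_sub, show k + 1 - 1 - n = k - n by omega, Nat.cast_sub (by omega), sub_sub_cancel_left]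

theorem isAssociated_aeval {A : ℝ⟦X⟧} (hA : PowerSeries.constantCoeff A = 1) (k : ℕ) :
    IsAssociated A k fun τ ↦ Polynomial.aeval (kleinJ τ) (faberCombination A k) := by
  have hO := isBigO_aeval_faberCombination_sub hA k
  refine ⟨⟨mdifferentiable_aeval_kleinJ _, fun γ τ ↦ by rw [kleinJ_smul], k, ?_⟩, hO⟩
  have hpow (n : ℕ) : (fun τ ↦ nome τ ^ n) =O[atImInfty] fun _ ↦ (1 : ℂ) :=
    (tendsto_nome.pow n).isBigO_one ℂ
  have hmul (n : ℕ) : (fun τ ↦ nome τ ^ ((n : ℤ) - (k : ℤ))) =O[atImInfty]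
      fun τ ↦ nome τ ^ (-(k : ℤ)) := by
    have := (hpow n).mul (isBigO_refl (fun τ ↦ nome τ ^ (-(k : ℤ))) atImInfty)
    simp only [one_mul] at this
    refine this.congr_left fun τ ↦ ?_
    rw [sub_eq_add_neg, zpow_add₀ (nome_ne_zero τ), zpow_natCast]
  have h1 : nome =O[atImInfty] fun τ ↦ nome τ ^ (-(k : ℤ)) := by
    refine (hmul (k + 1)).congr_left fun τ ↦ ?_
    push_cast
    rw [add_sub_cancel_left, zpow_one]
  have h2 : (fun τ ↦ ∑ n ∈ Finset.range (k + 1),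
      ((PowerSeries.coeff n A : ℝ) : ℂ) * nome τ ^ ((n : ℤ) - (k : ℤ))) =O[atImInfty]
      fun τ ↦ nome τ ^ (-(k : ℤ)) := .fun_sum fun n _ ↦ (hmul n).const_mul_left _
  exact ((hO.trans h1).add h2).congr_left fun τ ↦ sub_add_cancel _ _

/-- Two associated functions share all terms up to `q⁰`, so their difference is `O(q)` and vanishes.
-/
theorem isAssociated_iff {A : ℝ⟦X⟧} (hA : PowerSeries.constantCoeff A = 1) (k : ℕ) (f : ℍ → ℂ) :
    IsAssociated A k f ↔ f = fun τ ↦ Polynomial.aeval (kleinJ τ) (faberCombination A k) := by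
  refine ⟨fun hf ↦ ?_, fun hf ↦ hf ▸ isAssociated_aeval hA k⟩
  have hP := isAssociated_aeval hA k
  refine sub_eq_zero.mp (eq_zero_of_tendsto_zero (hf.1.holo.sub hP.1.holo) (fun γ τ ↦ ?_) ?_)
  · rw [Pi.sub_apply, Pi.sub_apply, hf.1.invariant, hP.1.invariant]
  · refine ((hf.2.sub hP.2).congr_left fun τ ↦ ?_).trans_tendsto tendsto_nome
    simp

/-! ### The arc of the unit circle -/

/-- The point `x + i √(1 - x²)` of the unit circle. -/
def arcPoint (x : ℝ) : ℍ := ofComplex ⟨x, √(1 - x ^ 2)⟩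

theorem one_sub_sq_pos {x : ℝ} (hx : x ∈ Set.Icc (0 : ℝ) (1 / 2)) : 0 < 1 - x ^ 2 := by
  nlinarith [hx.1, hx.2]

theorem coe_arcPoint {x : ℝ} (hx : x ∈ Set.Icc (0 : ℝ) (1 / 2)) :
    (arcPoint x : ℂ) = ⟨x, √(1 - x ^ 2)⟩ := by
  rw [arcPoint, ofComplex_apply_of_im_pos (Real.sqrt_pos.mpr (one_sub_sq_pos hx))]

theorem re_arcPoint {x : ℝ} (hx : x ∈ Set.Icc (0 : ℝ) (1 / 2)) : (arcPoint x).re = x := by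
  rw [← UpperHalfPlane.coe_re, coe_arcPoint hx]

theorem im_arcPoint {x : ℝ} (hx : x ∈ Set.Icc (0 : ℝ) (1 / 2)) :
    (arcPoint x).im = √(1 - x ^ 2) := by
  rw [← UpperHalfPlane.coe_im, coe_arcPoint hx]

theorem norm_arcPoint {x : ℝ} (hx : x ∈ Set.Icc (0 : ℝ) (1 / 2)) : ‖(arcPoint x : ℂ)‖ = 1 := by
  have h := Real.mul_self_sqrt (one_sub_sq_pos hx).le
  rw [coe_arcPoint hx, ← sq_eq_sq₀ (norm_nonneg _) zero_le_one, Complex.sq_norm,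
    Complex.normSq_mk, h]
  ring

/-- The modular invariant on the arc, as a real function of the abscissa. -/
def arcJ (x : ℝ) : ℝ := (kleinJ (arcPoint x)).re

theorem coe_arcJ {x : ℝ} (hx : x ∈ Set.Icc (0 : ℝ) (1 / 2)) :
    (arcJ x : ℂ) = kleinJ (arcPoint x) :=
  Complex.conj_eq_iff_re.mp (conj_kleinJ (norm_arcPoint hx))

theorem continuousOn_arcJ : ContinuousOn arcJ (Set.Icc 0 (1 / 2)) := by
  have h := (UpperHalfPlane.mdifferentiable_iff.mp mdifferentiable_kleinJ).continuousOn
  have hg : Continuous fun x : ℝ ↦ (⟨x, √(1 - x ^ 2)⟩ : ℂ) := by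
    simp only [Complex.mk_eq_add_mul_I]
    fun_prop
  exact Complex.continuous_re.comp_continuousOn
    (h.comp hg.continuousOn fun x hx ↦ Real.sqrt_pos.mpr (one_sub_sq_pos hx))

theorem arcJ_zero : arcJ 0 = 1728 := by
  have h0 : (0 : ℝ) ∈ Set.Icc (0 : ℝ) (1 / 2) := by norm_num
  have h : arcPoint 0 = UpperHalfPlane.I := by
    ext
    rw [coe_arcPoint h0]
    apply Complex.ext <;> simp
  rw [arcJ, h, kleinJ_I]
  norm_num

theorem arcJ_half : arcJ (1 / 2) = 0 := by
  have h0 : (1 / 2 : ℝ) ∈ Set.Icc (0 : ℝ) (1 / 2) := by norm_num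
  have h3 := Real.mul_self_sqrt (one_sub_sq_pos h0).le
  rw [arcJ, kleinJ_eq_zero, Complex.zero_re]
  rw [coe_arcPoint h0]
  apply Complex.ext
  · rw [pow_two, Complex.mul_re, Complex.sub_re, h3]
    norm_num
  · rw [pow_two, Complex.mul_im, Complex.sub_im]
    norm_num
    ring

theorem coe_aeval_arcJ {x : ℝ} (hx : x ∈ Set.Icc (0 : ℝ) (1 / 2)) (F : ℤ[X]) :
    ((Polynomial.aeval (arcJ x) F : ℝ) : ℂ) = Polynomial.aeval (kleinJ (arcPoint x)) F := by
  rw [← coe_arcJ hx]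
  exact (Polynomial.aeval_algebraMap_apply ℂ (arcJ x) F).symm

theorem abs_aeval_arcJ_sub_le {x : ℝ} (hx : x ∈ Set.Icc (0 : ℝ) (1 / 2)) {n : ℕ} (hn : 2 ≤ n) :
    |Polynomial.aeval (arcJ x) (faberPolynomial n) -
      (Real.exp (2 * π * n * (arcPoint x).im) * (2 * Real.cos (2 * π * n * x)) +
        (-1) ^ n * Real.exp (2 * π * n * ((arcPoint x).im / (2 - 2 * x))))| ≤
      1 / 2 * Real.exp (2 * π * n * (arcPoint x).im) := by
  have : NeZero n := ⟨by omega⟩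
  have h := norm_aeval_faberPolynomial_sub_le hn (norm_arcPoint hx)
    (by rw [re_arcPoint hx]; exact hx.1) (by rw [re_arcPoint hx]; exact hx.2)
  rw [← coe_aeval_arcJ hx, re_arcPoint hx] at h
  rw [← Real.norm_eq_abs, ← Complex.norm_real]
  push_cast at h ⊢
  exact h

theorem exp_third_le {x : ℝ} (hx : x ∈ Set.Icc (0 : ℝ) (1 / 2)) (n : ℕ) :
    Real.exp (2 * π * n * ((arcPoint x).im / (2 - 2 * x))) ≤
      Real.exp (2 * π * n * (arcPoint x).im) := by
  gcongr
  exact div_le_self (arcPoint x).im_pos.le (by linarith [hx.2])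

/-- If `j` agreed at abscissas `x < x'`, so would every `F_n(j)`. But `x` is the higher point, and
for large `n` with `cos(2πnx)` near 1 the value at `x` is at least `(1.8 - 1 - 0.5) e^{2πny}`, while
at `x'` it is at most `3.5 e^{2πny'}`. -/
theorem injOn_arcJ : Set.InjOn arcJ (Set.Icc 0 (1 / 2)) := by
  have key {x x' : ℝ} (hx : x ∈ Set.Icc (0 : ℝ) (1 / 2)) (hx' : x' ∈ Set.Icc (0 : ℝ) (1 / 2))
      (hlt : x < x') : arcJ x ≠ arcJ x' := by
    intro h
    have hy : (arcPoint x').im < (arcPoint x).im := by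
      rw [im_arcPoint hx, im_arcPoint hx']
      exact Real.sqrt_lt_sqrt (one_sub_sq_pos hx').le (by nlinarith [hx.1])
    -- The choice 12 makes the ratio of exponentials at least 13, and `0.3 · 13 = 3.9 > 3.5`.
    obtain ⟨N, hN⟩ := exists_nat_gt (12 / (2 * π * ((arcPoint x).im - (arcPoint x').im)))
    have hpos : 0 < 2 * π * ((arcPoint x).im - (arcPoint x').im) := by
      have := sub_pos.mpr hy
      positivity
    rw [div_lt_iff₀ hpos] at hN
    -- Dirichlet approximation: some `m ≤ 19` brings `m(N + 2)x` within `1/20` of an integer, hence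
    -- the cosine above 0.9. The summand 2 ensures `n ≥ 2`.
    obtain ⟨m, hm0, -, hm⟩ := Real.exists_nat_abs_mul_sub_round_le (((N + 2 : ℕ) : ℝ) * x)
      (n := 19) (by norm_num)
    set n := m * (N + 2) with hn
    have hNn : N + 2 ≤ n := Nat.le_mul_of_pos_left _ hm0
    have hcos : 0.9 ≤ Real.cos (2 * π * n * x) := by
      set r := round ((m : ℝ) * (((N + 2 : ℕ) : ℝ) * x))
      have e : Real.cos (2 * π * n * x) =
          Real.cos (2 * π * ((m : ℝ) * (((N + 2 : ℕ) : ℝ) * x) - r)) := by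
        rw [← Real.cos_sub_int_mul_two_pi _ r]
        congr 1
        rw [hn]
        push_cast
        ring
      rw [e]
      refine le_trans ?_ (Real.one_sub_sq_div_two_le_cos)
      set t := (m : ℝ) * (((N + 2 : ℕ) : ℝ) * x) - r
      have ht : t ^ 2 ≤ (1 / 20) ^ 2 := by
        rw [← sq_abs]
        norm_num at hm
        gcongr
      have hpi : π ^ 2 ≤ 3.15 ^ 2 := by
        gcongr
        exact Real.pi_lt_d2.le
      rw [mul_pow, mul_pow]
      nlinarith [sq_nonneg t, sq_nonneg π]
    have h1 := (abs_le.mp (abs_aeval_arcJ_sub_le hx (n := n) (by omega))).1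
    have h2 := (abs_le.mp (abs_aeval_arcJ_sub_le hx' (n := n) (by omega))).2
    rw [h] at h1
    have t1 := exp_third_le hx n
    have t2 := exp_third_le hx' n
    have hs : |((-1 : ℝ)) ^ n| = 1 := by simp
    have s1 := neg_abs_le (((-1 : ℝ)) ^ n * Real.exp (2 * π * n * ((arcPoint x).im / (2 - 2 * x))))
    have s2 := le_abs_self
      (((-1 : ℝ)) ^ n * Real.exp (2 * π * n * ((arcPoint x').im / (2 - 2 * x'))))
    rw [abs_mul, hs, one_mul, Real.abs_exp] at s1 s2
    have hE : Real.exp (2 * π * n * (arcPoint x).im) = Real.exp (2 * π * n * (arcPoint x').im) *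
        Real.exp (2 * π * n * ((arcPoint x).im - (arcPoint x').im)) := by
      rw [← Real.exp_add]
      ring_nf
    have hbig : 13 ≤ Real.exp (2 * π * n * ((arcPoint x).im - (arcPoint x').im)) := by
      have h3 := Real.add_one_le_exp (2 * π * n * ((arcPoint x).im - (arcPoint x').im))
      have h4 : (N : ℝ) ≤ n := by exact_mod_cast (by omega : N ≤ n)
      have h5 := mul_le_mul_of_nonneg_right h4 hpos.le
      linarith
    have c2 := Real.cos_le_one (2 * π * n * x')
    have p1 := Real.exp_pos (2 * π * n * (arcPoint x').im)
    have l1 := mul_le_mul_of_nonneg_left hcos (Real.exp_pos (2 * π * n * (arcPoint x).im)).le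
    have l2 := mul_le_mul_of_nonneg_left c2 p1.le
    have l3 := mul_le_mul_of_nonneg_left hbig p1.le
    rw [← hE] at l3
    linarith
  intro x hx x' hx' h
  by_contra hne
  rcases lt_or_gt_of_ne hne with hlt | hlt
  · exact key hx hx' hlt h
  · exact key hx' hx hlt h.symm

theorem strictAntiOn_arcJ : StrictAntiOn arcJ (Set.Icc 0 (1 / 2)) := by
  rcases continuousOn_arcJ.strictMonoOn_of_injOn_Icc' (by norm_num) injOn_arcJ with h | h
  · have := h (by norm_num : (0 : ℝ) ∈ Set.Icc (0 : ℝ) (1 / 2))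
      (by norm_num : (1 / 2 : ℝ) ∈ Set.Icc (0 : ℝ) (1 / 2)) (by norm_num)
    rw [arcJ_zero, arcJ_half] at this
    norm_num at this
  · exact h

theorem arcJ_mem_Icc {x : ℝ} (hx : x ∈ Set.Icc (0 : ℝ) (1 / 2)) :
    arcJ x ∈ Set.Icc (0 : ℝ) 1728 := by
  rw [← arcJ_half, ← arcJ_zero]
  exact ⟨strictAntiOn_arcJ.antitoneOn hx (by norm_num) hx.2,
    strictAntiOn_arcJ.antitoneOn (by norm_num) hx hx.1⟩

/-! ### Sign changes -/

theorem ncard_zeros_of_sign_changes {P : ℝ[X]} {k : ℕ} (hdeg : P.natDegree = k) {y : ℕ → ℝ}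
    {a b : ℝ} (hanti : ∀ i < k, y (i + 1) < y i) (hy : ∀ i ≤ k, y i ∈ Set.Icc a b)
    (hsign : ∀ i ≤ k, 0 < (-1) ^ i * P.eval (y i)) :
    {t : ℝ | t ∈ Set.Ioo a b ∧ P.eval t = 0}.ncard = k := by
  have hP : P ≠ 0 := by
    rintro rfl
    simpa using hsign 0 (Nat.zero_le k)
  have hsub : {t : ℝ | t ∈ Set.Ioo a b ∧ P.eval t = 0} ⊆ P.roots.toFinset := fun t ht ↦ by
    simp [hP, ht.2]
  have hfin := P.roots.toFinset.finite_toSet.subset hsub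
  refine le_antisymm ?_ ?_
  · refine (Set.ncard_le_ncard hsub P.roots.toFinset.finite_toSet).trans ?_
    rw [Set.ncard_coe_finset]
    exact (Multiset.toFinset_card_le _).trans (hdeg ▸ P.card_roots')
  · have hz (i : Fin k) : ∃ t ∈ Set.Ioo (y (i + 1)) (y i), P.eval t = 0 := by
      have hi := i.2
      have h1 := hsign i hi.le
      have h2 := hsign (i + 1) hi
      rw [pow_succ] at h2
      have hc : ContinuousOn (fun t ↦ (-1) ^ (i : ℕ) * P.eval t) (Set.Icc (y (i + 1)) (y i)) := by
        fun_prop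
      obtain ⟨t, ht, h0⟩ := intermediate_value_Ioo (hanti i hi).le hc
        (show (0 : ℝ) ∈ Set.Ioo _ _ from ⟨by linarith, h1⟩)
      exact ⟨t, ht, (mul_eq_zero.mp h0).resolve_left (by simp)⟩
    choose z hz h0 using hz
    have hle {i j : ℕ} (hij : i ≤ j) (hj : j ≤ k) : y j ≤ y i := by
      induction j, hij using Nat.le_induction with
      | base => exact le_rfl
      | succ j hij ih => exact (hanti j (by omega)).le.trans (ih (by omega))
    have hlt {i j : Fin k} (hij : i < j) : z j < z i :=
      (hz j).2.trans_le ((hle (Nat.succ_le_of_lt hij) j.2.le).trans (hz i).1.le)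
    have hinj : Function.Injective z := fun i j hij ↦ by
      by_contra hne
      rcases lt_or_gt_of_ne hne with h | h
      · exact (hlt h).ne hij.symm
      · exact (hlt h).ne hij
    have hrange : Set.range z ⊆ {t : ℝ | t ∈ Set.Ioo a b ∧ P.eval t = 0} := by
      rintro _ ⟨i, rfl⟩
      exact ⟨⟨(hy _ i.2).1.trans_lt (hz i).1, (hz i).2.trans_le (hy _ i.2.le).2⟩, h0 i⟩
    calc k = (Set.range z).ncard := by
          rw [← Set.image_univ, Set.ncard_image_of_injective _ hinj, Set.ncard_univ, Nat.card_fin]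
      _ ≤ _ := Set.ncard_le_ncard hrange hfin

/-! ### Bounds for Faber polynomials on the arc and signs at the sample points -/

theorem faberPolynomial_zero : faberPolynomial 0 = 1 :=
  Polynomial.eq_one_of_monic_natDegree_zero (faberPolynomial_monic 0) (faberPolynomial_natDegree 0)

theorem faberPolynomial_one : faberPolynomial 1 = Polynomial.X - Polynomial.C 744 := by
  have h := (faberPolynomial_monic 1).eq_X_add_C (faberPolynomial_natDegree 1)
  set c := (faberPolynomial 1).coeff 0
  have h1 := (isFaberPolynomial_faberPolynomial 1).isBigO.trans_tendsto tendsto_nome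
  have h2 := h1.sub tendsto_kleinJ_sub
  rw [h] at h2
  have h3 : Tendsto (fun _ : ℍ ↦ ((c + 744 : ℤ) : ℂ)) atImInfty (𝓝 (0 - 0)) := by
    refine h2.congr fun τ ↦ ?_
    simp
  have h4 := tendsto_nhds_unique tendsto_const_nhds h3
  rw [sub_zero, Int.cast_eq_zero] at h4
  rw [h, show c = -744 by omega]
  simp [sub_eq_add_neg]

/-- For `n ≥ 2` the constant `2 + 1 + 1/2` would do. The value 4.5 is dictated by `n = 1`: `|j -
744| ≤ 984 ≤ 4.5 · 220`. -/
theorem abs_aeval_arcJ_le {x : ℝ} (hx : x ∈ Set.Icc (0 : ℝ) (1 / 2)) (n : ℕ) :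
    |Polynomial.aeval (arcJ x) (faberPolynomial n)| ≤
      4.5 * Real.exp (2 * π * n * (arcPoint x).im) := by
  have hy := sqrt_three_div_two_le_im (norm_arcPoint hx) (by rw [re_arcPoint hx]; exact hx.1)
    (by rw [re_arcPoint hx]; exact hx.2)
  match n with
  | 0 => norm_num [faberPolynomial_zero]
  | 1 =>
    have h1 : Real.exp (π * √3) ≤ Real.exp (2 * π * (1 : ℕ) * (arcPoint x).im) := by
      rw [Real.exp_le_exp]
      push_cast
      nlinarith [Real.pi_pos]
    have h2 := arcJ_mem_Icc hx
    have h3 := two_twenty_le_exp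
    rw [faberPolynomial_one]
    simp only [map_sub, Polynomial.aeval_X, map_ofNat]
    refine le_trans ?_ (mul_le_mul_of_nonneg_left h1 (by norm_num))
    rw [abs_le]
    constructor <;> linarith [h2.1, h2.2]
  | n + 2 =>
    have h := abs_aeval_arcJ_sub_le hx (n := n + 2) (by omega)
    have ht := exp_third_le hx (n + 2)
    set E := Real.exp (2 * π * (n + 2 : ℕ) * (arcPoint x).im)
    set T := Real.exp (2 * π * (n + 2 : ℕ) * ((arcPoint x).im / (2 - 2 * x)))
    have hE : 0 < E := Real.exp_pos _
    have hT : 0 < T := Real.exp_pos _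
    have b1 : |E * (2 * Real.cos (2 * π * (n + 2 : ℕ) * x))| ≤ 2 * E := by
      rw [abs_mul, abs_mul, abs_of_pos hE, abs_two]
      nlinarith [Real.abs_cos_le_one (2 * π * (n + 2 : ℕ) * x)]
    have b2 : |(-1) ^ (n + 2) * T| = T := by simp [abs_of_pos hT]
    have b3 := abs_add_le (E * (2 * Real.cos (2 * π * (n + 2 : ℕ) * x))) ((-1) ^ (n + 2) * T)
    have b4 := abs_sub_abs_le_abs_sub (Polynomial.aeval (arcJ x) (faberPolynomial (n + 2)))
      (E * (2 * Real.cos (2 * π * (n + 2 : ℕ) * x)) + (-1) ^ (n + 2) * T)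
    linarith

/-- The sample point at which `F_k` has sign `(-1) ^ i`. -/
def sample (k i : ℕ) : ℝ := i / (2 * k)

theorem sample_mem {k i : ℕ} (hk : 1 ≤ k) (hi : i ≤ k) :
    sample k i ∈ Set.Icc (0 : ℝ) (1 / 2) := by
  have hk' : (0 : ℝ) < k := by exact_mod_cast hk
  have hi' : (i : ℝ) ≤ k := by exact_mod_cast hi
  rw [sample]
  refine ⟨by positivity, ?_⟩
  rw [div_le_div_iff₀ (by positivity) (by norm_num)]
  linarith

/-- For `n = 1` the three dominant terms collapse into one, so `F_1 = j - 744` is evaluated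
directly: 984 at `i` and -744 at `e^{πi/3}`. -/
theorem le_aeval_arcJ_sample_one {i : ℕ} (hi : i ≤ 1) :
    1.4 * Real.exp (2 * π * (1 : ℕ) * (arcPoint (sample 1 i)).im) ≤
      (-1) ^ i * Polynomial.aeval (arcJ (sample 1 i)) (faberPolynomial 1) := by
  have he : Real.exp 6 ≤ 404 := by
    rw [show (6 : ℝ) = ((6 : ℕ) : ℝ) * 1 by norm_num, Real.exp_nat_mul]
    calc Real.exp 1 ^ 6 ≤ 2.7182818286 ^ 6 := by
          gcongr
          exact Real.exp_one_lt_d9.le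
      _ ≤ 404 := by norm_num
  rw [faberPolynomial_one]
  simp only [map_sub, Polynomial.aeval_X, map_ofNat]
  interval_cases i
  · have hs : sample 1 0 = 0 := by simp [sample]
    have hy : (arcPoint 0).im = 1 := by
      rw [im_arcPoint (by norm_num)]
      simp
    have h03 : Real.exp 0.3 ≤ 1.43 := by
      have h := Real.one_sub_le_exp_neg 0.3
      rw [Real.exp_neg] at h
      rw [← inv_inv (Real.exp 0.3)]
      refine (inv_anti₀ (by norm_num) h).trans (by norm_num)
    have h2 : Real.exp (2 * π * (1 : ℕ) * 1) ≤ 404 * 1.43 := by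
      calc Real.exp (2 * π * (1 : ℕ) * 1) ≤ Real.exp (6 + 0.3) := by
            rw [Real.exp_le_exp]
            push_cast
            linarith [Real.pi_lt_d2]
        _ = Real.exp 6 * Real.exp 0.3 := Real.exp_add _ _
        _ ≤ 404 * 1.43 := by gcongr
    rw [hs, hy, arcJ_zero]
    linarith
  · have hs : sample 1 1 = 1 / 2 := by simp [sample]
    have hy : (arcPoint (1 / 2)).im ≤ 0.88 := by
      rw [im_arcPoint (by norm_num)]
      exact (Real.sqrt_le_left (by norm_num)).mpr (by norm_num)
    have h2 : Real.exp (2 * π * (1 : ℕ) * (arcPoint (1 / 2)).im) ≤ Real.exp 6 := by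
      rw [Real.exp_le_exp]
      push_cast
      nlinarith [Real.pi_lt_d2, Real.pi_pos]
    rw [hs, arcJ_half]
    linarith

/-- The cosine contributes 2, the error at most 1/2 and the third term at worst `-1/14`; the balance
exceeds 1.4. -/
theorem le_aeval_arcJ_sample {k i : ℕ} (hk : 1 ≤ k) (hi : i ≤ k) :
    1.4 * Real.exp (2 * π * k * (arcPoint (sample k i)).im) ≤
      (-1) ^ i * Polynomial.aeval (arcJ (sample k i)) (faberPolynomial k) := by
  rcases hk.eq_or_lt with rfl | hk2
  · exact le_aeval_arcJ_sample_one hi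
  have hx := sample_mem hk hi
  have hk' : (0 : ℝ) < k := by exact_mod_cast hk
  have hy := sqrt_three_div_two_le_im (norm_arcPoint hx) (by rw [re_arcPoint hx]; exact hx.1)
    (by rw [re_arcPoint hx]; exact hx.2)
  have h := abs_aeval_arcJ_sub_le hx hk2
  have hkx : 2 * k * sample k i = i := by
    rw [sample]
    field_simp
  have hcos : Real.cos (2 * π * k * sample k i) = (-1) ^ i := by
    rw [show 2 * π * k * sample k i = i * π by linear_combination π * hkx, Real.cos_nat_mul_pi]
  rw [hcos] at h
  set x := sample k i
  set y := (arcPoint x).im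
  have hy0 : 0 < y := (arcPoint x).im_pos
  set E := Real.exp (2 * π * k * y)
  have hE : 0 < E := Real.exp_pos _
  have hthird : -(1 / 14) * E ≤
      (-1) ^ i * ((-1) ^ k * Real.exp (2 * π * k * (y / (2 - 2 * x)))) := by
    rcases hi.eq_or_lt with rfl | hlt
    -- At the endpoint `i = k` the third term is as large as the others, but its sign `(-1)^i
    -- (-1)^k` is positive.
    · rw [← mul_assoc, ← mul_pow]
      simp only [mul_neg, mul_one, neg_neg, one_pow, one_mul]
      linarith [Real.exp_pos (2 * π * i * (y / (2 - 2 * x)))]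
    · have h14 : Real.exp (-(π * y)) ≤ 1 / 14 := by
        rw [Real.exp_neg, one_div]
        refine inv_anti₀ (by norm_num) ?_
        have h2 : Real.exp (π * √3) ≤ Real.exp (π * y) ^ 2 := by
          rw [← Real.exp_nat_mul, Real.exp_le_exp]
          push_cast
          nlinarith [Real.pi_pos]
        exact le_of_sq_le_sq (by linarith [two_twenty_le_exp]) (Real.exp_pos _).le
      have hki : (i : ℝ) + 1 ≤ k := by exact_mod_cast hlt
      have hd : 0 < 2 - 2 * x := by linarith [hx.2]
      -- Since `2kx = i ≤ k - 1`, the third exponent falls short of the main one by at least `πy`, a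
      -- factor `1/14`.
      have hexp : 2 * π * k * (y / (2 - 2 * x)) ≤ 2 * π * k * y + -(π * y) := by
        have e : 2 * k * (y / (2 - 2 * x)) ≤ 2 * k * y - y := by
          rw [mul_div_assoc', div_le_iff₀ hd]
          nlinarith [mul_nonneg hy0.le hx.1]
        nlinarith [Real.pi_pos]
      have hT : Real.exp (2 * π * k * (y / (2 - 2 * x))) ≤ E * (1 / 14) := by
        refine (Real.exp_le_exp.mpr hexp).trans ?_
        rw [Real.exp_add]
        gcongr
      have hs : |(-1 : ℝ) ^ i * ((-1) ^ k * Real.exp (2 * π * k * (y / (2 - 2 * x))))| =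
          Real.exp (2 * π * k * (y / (2 - 2 * x))) := by
        simp
      linarith [neg_abs_le ((-1 : ℝ) ^ i * ((-1) ^ k * Real.exp (2 * π * k * (y / (2 - 2 * x)))))]
  set F := Polynomial.aeval (arcJ x) (faberPolynomial k)
  set T := (-1) ^ k * Real.exp (2 * π * k * (y / (2 - 2 * x)))
  have hmul : |(-1) ^ i * (F - (E * (2 * (-1) ^ i) + T))| ≤ 1 / 2 * E := by
    rw [abs_mul]
    simpa using h
  have hsq : (-1 : ℝ) ^ i * (-1) ^ i = 1 := by rw [← mul_pow]; norm_num
  have e : (-1) ^ i * (F - (E * (2 * (-1) ^ i) + T)) = (-1) ^ i * F - 2 * E - (-1) ^ i * T := by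
    linear_combination (-2 * E) * hsq
  rw [e] at hmul
  linarith [(abs_le.mp hmul).1]

/-- Since `y ≥ √3/2`, `e^{2πny} ≤ e^{2πky} e^{-π(k-n)√3}`. After the reflection `m = k - 1 - n` the
lower terms are bounded by `4.5 e^{2πky}` times a partial sum of `S`. -/
theorem sign_eval_faberCombination {A : ℝ⟦X⟧} {S : ℝ} (hS4 : S ≤ 0.284)
    (hsum : ∀ k : ℕ, ∑ m ∈ Finset.range k, |PowerSeries.coeff (m + 1) A| *
      Real.exp (-π * ((m : ℝ) + 1) * √3) ≤ S) {k i : ℕ} (hk : 1 ≤ k) (hi : i ≤ k) :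
    0 < (-1) ^ i * (faberCombination A k).eval (arcJ (sample k i)) := by
  have hx := sample_mem hk hi
  have hy := sqrt_three_div_two_le_im (norm_arcPoint hx) (by rw [re_arcPoint hx]; exact hx.1)
    (by rw [re_arcPoint hx]; exact hx.2)
  have hmain := le_aeval_arcJ_sample hk hi
  set x := sample k i
  set y := (arcPoint x).im
  set E := Real.exp (2 * π * k * y) with hE
  have hE0 : 0 < E := Real.exp_pos _
  have hterm (n : ℕ) (hn : n ∈ Finset.range k) :
      ‖PowerSeries.coeff (k - n) A * Polynomial.aeval (arcJ x) (faberPolynomial n)‖ ≤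
        4.5 * E * (|PowerSeries.coeff (k - 1 - n + 1) A| *
          Real.exp (-π * (((k - 1 - n : ℕ) : ℝ) + 1) * √3)) := by
    have hn' := Finset.mem_range.mp hn
    have hcast : ((k - 1 - n : ℕ) : ℝ) + 1 = k - n := by
      rw [← Nat.cast_add_one, show k - 1 - n + 1 = k - n by omega, Nat.cast_sub hn'.le]
    have hkn : (n : ℝ) ≤ k := by exact_mod_cast hn'.le
    have hexp : Real.exp (2 * π * n * y) ≤ E * Real.exp (-π * ((k : ℝ) - n) * √3) := by
      rw [hE, ← Real.exp_add, Real.exp_le_exp]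
      have := mul_le_mul_of_nonneg_left hy (mul_nonneg Real.pi_pos.le (sub_nonneg.mpr hkn))
      linarith
    rw [hcast, show k - 1 - n + 1 = k - n by omega, Real.norm_eq_abs, abs_mul]
    calc |PowerSeries.coeff (k - n) A| * |Polynomial.aeval (arcJ x) (faberPolynomial n)|
        ≤ |PowerSeries.coeff (k - n) A| *
          (4.5 * (E * Real.exp (-π * ((k : ℝ) - n) * √3))) := by
          gcongr
          exact (abs_aeval_arcJ_le hx n).trans (by gcongr)
      _ = _ := by ring
  have hrest := norm_sum_le_of_le _ hterm
  rw [← Finset.mul_sum, Finset.sum_range_reflect (fun m : ℕ ↦ |PowerSeries.coeff (m + 1) A| *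
    Real.exp (-π * ((m : ℝ) + 1) * √3)) k, Real.norm_eq_abs] at hrest
  rw [eval_faberCombination, mul_add]
  set R := ∑ n ∈ Finset.range k,
    PowerSeries.coeff (k - n) A * Polynomial.aeval (arcJ x) (faberPolynomial n)
  have hR : |(-1) ^ i * R| ≤ 4.5 * E * 0.284 := by
    rw [abs_mul, abs_pow, abs_neg, abs_one, one_pow, one_mul]
    exact hrest.trans (by gcongr; exact (hsum k).trans hS4)
  linarith [neg_abs_le ((-1) ^ i * R)]

end

end FaberZeros

theorem corollary1p2 (A : PowerSeries ℝ) (hA : PowerSeries.constantCoeff A = 1)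
    (M : ℝ) (hM : 1.1176 ≤ M)
    (hsum : Summable fun n : ℕ ↦
      |PowerSeries.coeff (n + 1) A| * Real.exp (-Real.pi * ((n : ℝ) + 1) * Real.sqrt 3))
    (hS : ∑' n : ℕ, |PowerSeries.coeff (n + 1) A| *
      Real.exp (-Real.pi * ((n : ℝ) + 1) * Real.sqrt 3) < (2 - M) / (2 + M))
    (k : ℕ) (hk : 1 ≤ k) :
    (FaberZeros.faberCombination A k).natDegree = k ∧
    (∀ f : UpperHalfPlane → ℂ, FaberZeros.IsAssociated A k f ↔
      f = fun τ ↦ Polynomial.aeval (FaberZeros.kleinJ τ) (FaberZeros.faberCombination A k)) ∧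
    {y : ℝ | y ∈ Set.Ioo (0 : ℝ) 1728 ∧
      (FaberZeros.faberCombination A k).eval y = 0}.ncard = k := by
  have hdeg := FaberZeros.natDegree_faberCombination A hk
  refine ⟨hdeg, fun f ↦ FaberZeros.isAssociated_iff hA k f,
    FaberZeros.ncard_zeros_of_sign_changes hdeg
      (y := fun i ↦ FaberZeros.arcJ (FaberZeros.sample k i)) (fun i hi ↦ ?_)
      (fun i hi ↦ FaberZeros.arcJ_mem_Icc (FaberZeros.sample_mem hk hi)) (fun i hi ↦ ?_)⟩
  · refine FaberZeros.strictAntiOn_arcJ (FaberZeros.sample_mem hk hi.le)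
      (FaberZeros.sample_mem hk hi) ?_
    have hk' : (0 : ℝ) < k := by exact_mod_cast hk
    unfold FaberZeros.sample
    gcongr
    simp
  · refine FaberZeros.sign_eval_faberCombination (hS.le.trans ?_)
      (fun k ↦ hsum.sum_le_tsum _ fun n _ ↦ by positivity) hk hi
    -- `(2 - M)/(2 + M)` is decreasing in `M` and about 0.283 at `M = 1.1176`.
    rw [div_le_iff₀ (by linarith)]
    linarith
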